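/- Theorem 4.1. Let $\delta>0$ and let everything be periodic in $x$ with period $1$. Let $\Omega=(0,1]\times(-\delta,1]$, $D=(0,1]^2$, $\mathcal U=\Omega\setminus D=(0,1]\times(-\delta,0]$, and for $h=1/N$, $N\in\mathbb N$, $N\ge 1$, let $\Omega_h=\Omega\cap h\mathbb Z^2$, $D_h=D\cap h\mathbb Z^2$, $\mathcal U_h=\mathcal U\cap h\mathbb Z^2$. Fix $r\in\mathbb N$, $r\ge 2$, and put $\epsilon=rh$. **Boundary data.** $u_0:\mathcal U\to\mathbb R^d$ is $1$-periodic in $x$ and $C^2$ off finitely many (possibly no) curves, taken periodically in $x$. Each curve is a graph $y=f(x)$ of a smooth increasing function $f$ on an interval, lies in $\mathcal U$, and meets the line $y=0$ at a strictly positive angle. Near every point of $\mathcal U$, $u_0$ is bounded and, off the curves, so is its first derivative (so the discontinuities are jumps). **Algorithm.** Let ${\bf g}\in\mathbb R^2$ and $\mu>0$ be constant, and set $$w_\epsilon({\bf x},{\bf y})=\frac1{\|{\bf y}-{\bf x}\|}\exp\Big(-\frac{\mu^2}{2\epsilon^2}\big({\bf g}^\perp\cdot({\bf y}-{\bf x})\big)^2\Big).$$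 The neighbourhood $A_{\epsilon,h}({\bf x})$ is either $B_{\epsilon,h}({\bf x})=\{{\bf y}\in\Omega_h:\|{\bf y}-{\bf x}\|\le\epsilon\}$ (coherence transport) or $\tilde B_{\epsilon,h}({\bf x})=\Omega\cap\{{\bf x}+R{\bf y}:{\bf y}\in h\mathbb Z^2,\ \|{\bf y}\|\le\epsilon\}$ (Guidefill), where $R$ is the rotation taking $(0,1)$ to ${\bf g}/\|{\bf g}\|$, and $R=I$ if ${\bf g}={\bf 0}$. Start with $u_h=u_0$ on $\mathcal U_h$ and $D_h^{(0)}=D_h$. In step $k=0,1,2,\dots$, as long as $D_h^{(k)}\ne\emptyset$, let $D^{(k)}$ be the set of points of $\Omega$ at distance less than $h$ (in the maximum norm) from a pixel of $D_h^{(k)}$. Every pixel ${\bf x}\in D^{(k)}_h$ having one of its eight neighbours in $\Omega_h\setminus D_h^{(k)}$ is given the value $$u_h({\bf x})=\frac{\sum_{{\bf y}\in A_{\epsilon,h}({\bf x})\cap(\Omega\setminus D^{(k)})}w_\epsilon({\bf x},{\bf y})\,u_h({\bf y})}{\sum_{{\bf y}\in A_{\epsilon,h}({\bf x})\cap(\Omega\setminus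 D^{(k)})}w_\epsilon({\bf x},{\bf y})},$$ where $u_h$ is evaluated between pixels by bilinear interpolation. $D_h^{(k+1)}$ is $D_h^{(k)}$ without these pixels. **Limit.** Let $A_r=\{{\bf y}\in\mathbb Z^2:\|{\bf y}\|\le r\}$ for coherence transport and $A_r=R\{{\bf y}\in\mathbb Z^2:\|{\bf y}\|\le r\}$ for Guidefill, let $A_r^-=\{{\bf y}\in A_r:y_2\le-1\}$, and $${\bf g}^*=\frac{\sum_{{\bf y}\in A_r^-}w_r({\bf 0},{\bf y})\,{\bf y}}{\sum_{{\bf y}\in A_r^-}w_r({\bf 0},{\bf y})}.$$ If ${\bf g}^*\cdot e_2\ne0$, let $\theta^*\in(0,\pi)$ be the counterclockwise angle from the $x$-axis to the line spanned by ${\bf g}^*$. The weak solution on $D$ of the transport equation $\nabla u\cdot{\bf g}^*=0$ with $u(x,0)=u_0(x,0)$, periodic in $x$, is by definition $u(x,y)=u_0\big((x-\cot(\theta^*)\,y)\bmod 1,\,0\big)$. **Claim.** There is a constant $K$ depending only on $u_0$ (including its domain) and $r$ such that, for either choice of neighbourhood and all ${\bf g}\in\mathbb R^2$ and $\mu>0$: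 ${\bf g}^*\cdot e_2\neq0$, so that $u$ exists; and for every $h=1/N<\delta/r$ the algorithm fills all of $D_h$, and for every $p\in[1,\infty]$ and each channel (component) of $u$ and $u_h$, $$\|u-u_h\|_p\le K\,h^{\frac1{2p}}\ \text{ if the set of curves is non-empty},\qquad \|u-u_h\|_p\le K\,h\ \text{ if there are no curves,}$$ where $\frac1{2p}=0$ for $p=\infty$, $\|f\|_p=\big(\sum_{{\bf x}\in D_h}|f({\bf x})|^p h^2\big)^{1/p}$ for $p<\infty$, and $\|f\|_\infty=\max_{{\bf x}\in D_h}|f({\bf x})|$. -/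

import Mathlib

open scoped ENNReal ContDiff

noncomputable section

namespace Inpainting

/-! Points of the plane are pairs of reals.  Periodicity in `x` is modelled on the universal cover:
all regions are horizontal strips of the plane, pixels are indexed by `ℤ × ℤ`, and the data are
`1`-periodic in `x`. -/

/-- The Euclidean norm on `ℝ × ℝ` (whose built-in norm is the maximum norm). -/
def eucl (v : ℝ × ℝ) : ℝ := Real.sqrt (v.1 ^ 2 + v.2 ^ 2)

/-- The counterclockwise rotation of `v` by a right angle. -/
def perp (v : ℝ × ℝ) : ℝ × ℝ := (-v.2, v.1)

/-! ### Domains -/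

/-- The image domain `(0,1] × (-δ,1]`, periodic in `x`. -/
def imageDomain (δ : ℝ) : Set (ℝ × ℝ) := {z | -δ < z.2 ∧ z.2 ≤ 1}

/-- The inpainting domain `(0,1] × (0,1]`, periodic in `x`. -/
def inpaintingDomain : Set (ℝ × ℝ) := {z | 0 < z.2 ∧ z.2 ≤ 1}

/-- The undamaged region `(0,1] × (-δ,0]`, periodic in `x`. -/
def undamaged (δ : ℝ) : Set (ℝ × ℝ) := {z | -δ < z.2 ∧ z.2 ≤ 0}

/-- The centre `(i h, j h)` of the pixel `(i, j)`. -/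
def pos (h : ℝ) (q : ℤ × ℤ) : ℝ × ℝ := (q.1 * h, q.2 * h)

/-- The pixels whose centres lie in `S`. -/
def pixelsIn (S : Set (ℝ × ℝ)) (h : ℝ) : Set (ℤ × ℤ) := {q | pos h q ∈ S}

/-- The continuous version of a set `Dh` of pixels inside `Ω`, with its one pixel wide buffer:
the points of `Ω` at distance less than `h`, in the maximum norm, from a pixel of `Dh`. -/
def continuousRegion (Ω : Set (ℝ × ℝ)) (h : ℝ) (Dh : Set (ℤ × ℤ)) : Set (ℝ × ℝ) :=
  {z ∈ Ω | ∃ q ∈ Dh, ‖pos h q - z‖ < h}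

/-! ### Neighbourhoods and weights -/

/-- The two algorithms considered. -/
inductive Scheme where
  | coherenceTransport
  | guidefill

/-- The rotation of the plane that takes `(0,1)` to `g / ‖g‖`, and the identity if `g = 0`. -/
def rotateTo (g y : ℝ × ℝ) : ℝ × ℝ :=
  open Classical in
  if g = 0 then y
  else ((y.1 * g.2 + y.2 * g.1) / eucl g, (-(y.1 * g.1) + y.2 * g.2) / eucl g)

/-- The neighbourhood of radius `ε` of `x` in `Ω`: the ball of the lattice `h ℤ²` for coherence
transport, and that ball rotated about `x` into the direction `g` for Guidefill. -/
def neighbourhood (s : Scheme) (Ω : Set (ℝ × ℝ)) (g : ℝ × ℝ) (h ε : ℝ) (x : ℝ × ℝ) :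
    Set (ℝ × ℝ) :=
  match s with
  | .coherenceTransport => {z ∈ Ω | (∃ q, z = pos h q) ∧ eucl (z - x) ≤ ε}
  | .guidefill => {z ∈ Ω | ∃ q, eucl (pos h q) ≤ ε ∧ z = x + rotateTo g (pos h q)}

/-- The weight `‖y - x‖⁻¹ exp (-(μ² / (2 ε²)) (g^⊥ ⬝ (y - x))²)`. -/
def weight (μ : ℝ) (g : ℝ × ℝ) (ε : ℝ) (x y : ℝ × ℝ) : ℝ :=
  1 / eucl (y - x) *
    Real.exp (-(μ ^ 2 / (2 * ε ^ 2)) *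
      ((perp g).1 * (y - x).1 + (perp g).2 * (y - x).2) ^ 2)

/-! ### Shell based inpainting, onion shell order, no bystander pixels -/

/-- The basis function of bilinear interpolation at the pixel `q`. -/
def bilinearBasis (h : ℝ) (q : ℤ × ℤ) (z : ℝ × ℝ) : ℝ :=
  max 0 (1 - |z.1 - (pos h q).1| / h) * max 0 (1 - |z.2 - (pos h q).2| / h)

/-- Bilinear interpolation of the pixel values `u` (only finitely many terms are nonzero). -/
def interpolate {d : ℕ} (Ω : Set (ℝ × ℝ)) (h : ℝ) (u : ℤ × ℤ → Fin d → ℝ) (z : ℝ × ℝ) :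
    Fin d → ℝ :=
  ∑ᶠ q ∈ pixelsIn Ω h, bilinearBasis h q z • u q

/-- The eight-point neighbourhood of a pixel. -/
def eightNeighbours (q : ℤ × ℤ) : Set (ℤ × ℤ) :=
  {q' | q' ≠ q ∧ |q'.1 - q.1| ≤ 1 ∧ |q'.2 - q.2| ≤ 1}

/-- The discrete inner boundary of a set of pixels. -/
def innerBoundary (Dh : Set (ℤ × ℤ)) : Set (ℤ × ℤ) :=
  {q ∈ Dh | (eightNeighbours q ∩ Dhᶜ).Nonempty}

/-- The active boundary: the boundary pixels with a readable neighbour. -/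
def activeBoundary (Ω : Set (ℝ × ℝ)) (h : ℝ) (Dh : Set (ℤ × ℤ)) : Set (ℤ × ℤ) :=
  {q ∈ innerBoundary Dh | (eightNeighbours q ∩ (pixelsIn Ω h \ Dh)).Nonempty}

/-- The state of the algorithm: the pixels still to be filled and the current image. -/
structure State (d : ℕ) where
  region : Set (ℤ × ℤ)
  image : ℤ × ℤ → Fin d → ℝ

/-- The weighted average over the readable part of the neighbourhood `A x`. -/
def fillValue {d : ℕ} (Ω : Set (ℝ × ℝ)) (h : ℝ) (A : ℝ × ℝ → Set (ℝ × ℝ))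
    (w : ℝ × ℝ → ℝ × ℝ → ℝ) (S : State d) (x : ℝ × ℝ) : Fin d → ℝ :=
  (∑ᶠ y ∈ A x ∩ (Ω \ continuousRegion Ω h S.region), w x y)⁻¹ •
    ∑ᶠ y ∈ A x ∩ (Ω \ continuousRegion Ω h S.region), w x y • interpolate Ω h S.image y

/-- One iteration: every pixel of the active boundary is filled and removed from the region. -/
def fillShell {d : ℕ} (Ω : Set (ℝ × ℝ)) (h : ℝ) (A : ℝ × ℝ → Set (ℝ × ℝ))
    (w : ℝ × ℝ → ℝ × ℝ → ℝ) (S : State d) : State d where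
  region := S.region \ activeBoundary Ω h S.region
  image := fun q =>
    open Classical in
    if q ∈ activeBoundary Ω h S.region then fillValue Ω h A w S (pos h q) else S.image q

/-- The initial state: the pixels of the inpainting domain are to be filled (and hold the value
`0`, which is never read); the others carry the values of `u₀`. -/
def initialState {d : ℕ} (u₀ : ℝ × ℝ → Fin d → ℝ) (h : ℝ) : State d where
  region := pixelsIn inpaintingDomain h
  image := fun q =>
    open Classical in
    if q ∈ pixelsIn inpaintingDomain h then 0 else u₀ (pos h q)

/-- The state after `k` iterations with pixel width `h` and radius `ε = r h`. -/
def stateAfter {d : ℕ} (s : Scheme) (δ : ℝ) (u₀ : ℝ × ℝ → Fin d → ℝ) (g : ℝ × ℝ) (μ : ℝ)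
    (r : ℕ) (h : ℝ) (k : ℕ) : State d :=
  (fillShell (imageDomain δ) h (neighbourhood s (imageDomain δ) g h (r * h))
    (weight μ g (r * h)))^[k] (initialState u₀ h)

/-- The output `u_h`: the image at the first step at which no pixel remains to be filled. -/
def inpainted {d : ℕ} (s : Scheme) (δ : ℝ) (u₀ : ℝ × ℝ → Fin d → ℝ) (g : ℝ × ℝ) (μ : ℝ)
    (r : ℕ) (h : ℝ) : ℤ × ℤ → Fin d → ℝ :=
  (stateAfter s δ u₀ g μ r h (sInf {k | (stateAfter s δ u₀ g μ r h k).region = ∅})).image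

/-! ### The limiting transport direction and the weak solution -/

/-- The discrete half-ball `A_r^-`, in units of one pixel. -/
def halfBall (s : Scheme) (g : ℝ × ℝ) (r : ℕ) : Set (ℝ × ℝ) :=
  {y ∈ neighbourhood s Set.univ g 1 r 0 | y.2 ≤ -1}

/-- The weighted centre of mass `g*` of the half-ball. -/
def transportDirection (s : Scheme) (g : ℝ × ℝ) (μ : ℝ) (r : ℕ) : ℝ × ℝ :=
  (∑ᶠ y ∈ halfBall s g r, weight μ g r 0 y)⁻¹ •
    ∑ᶠ y ∈ halfBall s g r, weight μ g r 0 y • y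

/-- `θ ∈ (0, π)` is the counterclockwise angle from the `x`-axis to the line spanned by `v`. -/
def IsLineAngle (v : ℝ × ℝ) (θ : ℝ) : Prop :=
  v ≠ 0 ∧ θ ∈ Set.Ioo 0 Real.pi ∧ v.1 * Real.sin θ = v.2 * Real.cos θ

/-- The weak solution of the transport equation along the direction of angle `θ`, with boundary
values `u₀ (x, 0)`; as `u₀` is `1`-periodic in `x`, no reduction mod `1` is needed. -/
def weakSolution {d : ℕ} (u₀ : ℝ × ℝ → Fin d → ℝ) (θ : ℝ) (z : ℝ × ℝ) : Fin d → ℝ :=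
  u₀ (z.1 - Real.cot θ * z.2, 0)

/-! ### Boundary data -/

/-- A smooth curve in the undamaged region, the graph `y = f x` of an increasing function over an
interval, which meets the line `y = 0` at a positive angle. -/
structure JumpCurve (δ : ℝ) where
  interval : Set ℝ
  f : ℝ → ℝ
  ordConnected : interval.OrdConnected
  smooth : ContDiffOn ℝ ∞ f interval
  monotone : MonotoneOn f interval
  mapsTo : Set.MapsTo f interval (Set.Ioc (-δ) 0)
  meets : ∃ a ∈ interval, f a = 0 ∧ 0 < derivWithin f interval a

/-- The union of the curves and of all their translates by integers in the direction of `x`. -/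
def jumpSet {δ : ℝ} {n : ℕ} (C : Fin n → JumpCurve δ) : Set (ℝ × ℝ) :=
  {z | ∃ i, ∃ x ∈ (C i).interval, ∃ m : ℤ, z = (x + m, (C i).f x)}

/-- `u₀` is piecewise `C²` on the (periodic) undamaged region: it is `1`-periodic in `x`, it is `C²`
off the curves, and `u₀` and its first derivative off the curves are bounded near every point of
the region (so that the discontinuities across the curves are jumps). -/
structure IsPiecewiseC2 {d : ℕ} (δ : ℝ) (u₀ : ℝ × ℝ → Fin d → ℝ) {n : ℕ}
    (C : Fin n → JumpCurve δ) : Prop where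
  periodic : ∀ z ∈ undamaged δ, u₀ (z.1 + 1, z.2) = u₀ z
  contDiffOn : ContDiffOn ℝ 2 u₀ (undamaged δ \ jumpSet C)
  locallyBounded : ∀ z ∈ undamaged δ, ∃ M : ℝ, ∀ᶠ w in nhdsWithin z (undamaged δ),
    ‖u₀ w‖ ≤ M ∧
      (w ∉ jumpSet C → ‖fderivWithin ℝ u₀ (undamaged δ \ jumpSet C) w‖ ≤ M)

/-! ### Discrete norms -/

/-- The `N × N` pixels of one period of the inpainting domain. -/
def pixelGrid (N : ℕ) : Finset (ℤ × ℤ) := Finset.Icc 1 (N : ℤ) ×ˢ Finset.Icc 1 (N : ℤ)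

/-- The discrete `L^p` norm on the `N × N` grid, with pixel width `1 / N`. -/
def discreteNorm (p : ℝ≥0∞) (N : ℕ) (f : ℤ × ℤ → ℝ) : ℝ :=
  open Classical in
  if p = ⊤ then ⨆ q : pixelGrid N, |f q|
  else (∑ q ∈ pixelGrid N, |f q| ^ p.toReal * (1 / (N : ℝ)) ^ 2) ^ (1 / p.toReal)

end Inpainting

end

open Inpainting

/-! The remaining region is always a block of full pixel rows, so each step fills exactly one row.
The one-pixel buffer restricts the readable neighbours of a pixel to the offsets `y` with `y.2 ≤
-1`. After scaling by `h`, these form the fixed half-ball `halfBall s g r`. Bilinear interpolation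
reproduces affine functions, so a filled value is an average of pixel values at integer offsets in
rows `-r, …, -1`, with nonnegative weights of mass one and mean exactly `g*`
(`isStencil_stencilWeight`, `inpainted_spec`). Since every offset descends at least one row, `g*` is
not horizontal.

Reading the average as a random walk, the value at a pixel is the expected boundary value where the
walk leaves the domain. Let `ζ` be the horizontal deviation from the line through the pixel in
direction `g*`. It has mean zero at every step and variance `O(h²)` per step, and there are `O(1/h)`
steps, so its exit variance is `O(h)`. `abs_sub_le_of_boundary` states this without probability: if
the boundary values differ from `c + β ζ` by at most `A + B ζ²`, then the error is at most `A + B ·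
O(h)`.

Without jumps, Taylor expansion at the foot `x'` of the characteristic gives `A = O(h)` and `B =
O(1)`. The linear term costs nothing because `ζ` has mean zero. Hence the error is `O(h)` uniformly.

With jumps, positive angles confine the discontinuities near `y = 0` to cones with finitely many
apices `a` (`exists_jump_cones`). A boundary pixel separated from the foot by a jump has `|ζ| ≥ |x'
- a| / 2` once `h` is small and `|x' - a| > √h`. A Chebyshev argument then bounds the error by a
multiple of `√h + ∑ h / ((x' - a)² + h)` (`exists_error_le`). Each such sum over a row of `N` pixels
is `O(N √h)` (`sum_row_le`), so the `L¹` error is `O(√h)`. Together with a uniform bound, this gives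
`h ^ (1 / (2 p))` in `L^p`. All constants depend on the stencil only through `r`, hence not on `g`,
`μ` or the scheme. -/

namespace Inpainting

/-! ### Averaging stencils -/

/-- The offsets read by an averaging stencil of radius `r`. -/
noncomputable def stencilBox (r : ℕ) : Finset (ℤ × ℤ) :=
  Finset.Icc (-(r : ℤ)) r ×ˢ Finset.Icc (-(r : ℤ)) (-1)

theorem mem_stencilBox {r : ℕ} {q : ℤ × ℤ} :
    q ∈ stencilBox r ↔ (-(r : ℤ) ≤ q.1 ∧ q.1 ≤ r) ∧ -(r : ℤ) ≤ q.2 ∧ q.2 ≤ -1 := by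
  simp [stencilBox]

/-- Nonnegative weights of total mass `1` on the offsets of radius `r`, with mean `v`. -/
structure IsStencil (r : ℕ) (ρ : ℤ × ℤ → ℝ) (v : ℝ × ℝ) : Prop where
  nonneg : ∀ q, 0 ≤ ρ q
  sum_eq_one : ∑ q ∈ stencilBox r, ρ q = 1
  sum_fst : ∑ q ∈ stencilBox r, ρ q * q.1 = v.1
  sum_snd : ∑ q ∈ stencilBox r, ρ q * q.2 = v.2

namespace IsStencil

variable {r : ℕ} {ρ : ℤ × ℤ → ℝ} {v : ℝ × ℝ}

theorem sum_le (hρ : IsStencil r ρ v) {f : ℤ × ℤ → ℝ} {c : ℝ}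
    (hf : ∀ q ∈ stencilBox r, f q ≤ c) : ∑ q ∈ stencilBox r, ρ q * f q ≤ c := by
  calc ∑ q ∈ stencilBox r, ρ q * f q ≤ ∑ q ∈ stencilBox r, ρ q * c :=
        Finset.sum_le_sum fun q hq => mul_le_mul_of_nonneg_left (hf q hq) (hρ.nonneg q)
    _ = c := by rw [← Finset.sum_mul, hρ.sum_eq_one, one_mul]

/-- Every offset descends at least one row, hence so does the mean. This is what makes `g*`
transversal to the boundary line. -/
theorem snd_le (hρ : IsStencil r ρ v) : v.2 ≤ -1 := by
  rw [← hρ.sum_snd]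
  refine hρ.sum_le fun q hq => ?_
  exact_mod_cast (mem_stencilBox.1 hq).2.2

theorem abs_fst_le (hρ : IsStencil r ρ v) : |v.1| ≤ r := by
  rw [abs_le]
  constructor
  · have h := hρ.sum_le (f := fun q => -(q.1 : ℝ)) (c := r) fun q hq => by
      have := (mem_stencilBox.1 hq).1.1
      have : (-(r : ℝ)) ≤ q.1 := by exact_mod_cast this
      linarith
    simp only [mul_neg, Finset.sum_neg_distrib, hρ.sum_fst] at h
    linarith
  · rw [← hρ.sum_fst]
    refine hρ.sum_le fun q hq => ?_
    exact_mod_cast (mem_stencilBox.1 hq).1.2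

theorem abs_slope_le (hρ : IsStencil r ρ v) : |v.1 / v.2| ≤ r := by
  have h2 := hρ.snd_le
  have h1 : 1 ≤ |v.2| := by rw [abs_of_neg (by linarith)]; linarith
  rw [abs_div, div_le_iff₀ (by linarith)]
  nlinarith [hρ.abs_fst_le, Nat.cast_nonneg (α := ℝ) r]

theorem sum_linear (hρ : IsStencil r ρ v) (a b c : ℝ) :
    ∑ q ∈ stencilBox r, ρ q * (a + b * q.1 + c * q.2) = a + b * v.1 + c * v.2 := by
  rw [← hρ.sum_fst, ← hρ.sum_snd, Finset.mul_sum, Finset.mul_sum]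
  nth_rewrite 2 [← mul_one a]
  rw [← hρ.sum_eq_one, Finset.mul_sum, ← Finset.sum_add_distrib, ← Finset.sum_add_distrib]
  exact Finset.sum_congr rfl fun q _ => by ring

/-- **Comparison with a quadratic barrier.** A function that is averaged by the stencil on the rows
`1, …, N`, and whose values on the rows `-r < j ≤ 0` differ from those of an affine function that is
constant along the mean of the stencil by at most `A + B ζ²`, is close to that affine function. -/
theorem abs_sub_le_of_boundary (hρ : IsStencil r ρ v) {N : ℕ} {U : ℤ × ℤ → ℝ}
    (hU : ∀ p : ℤ × ℤ, 1 ≤ p.2 → p.2 ≤ N → U p = ∑ q ∈ stencilBox r, ρ q * U (p + q))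
    {h : ℝ} (hh : h * N = 1) {p₀ : ℤ × ℤ} (h1 : 1 ≤ p₀.2) (hN : p₀.2 ≤ N)
    {ζ : ℤ × ℤ → ℝ}
    (hζ : ∀ p, ζ p = p.1 * h - (p₀.1 * h - v.1 / v.2 * (p₀.2 * h)) - v.1 / v.2 * (p.2 * h))
    {A B β c : ℝ} (hB : 0 ≤ B)
    (hbd : ∀ p : ℤ × ℤ, -(r : ℤ) < p.2 → p.2 ≤ 0 → |p.1 - p₀.1| ≤ r * (p₀.2 - p.2) →
      |U p - c - β * ζ p| ≤ A + B * ζ p ^ 2) :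
    |U p₀ - c| ≤ A + B * ((r + r ^ 2) ^ 2 * (1 + r) * h) := by
  set m := v.1 / v.2 with hm
  have hv2 : v.2 ≠ 0 := by have := hρ.snd_le; intro h; linarith
  have hmr : |m| ≤ r := hρ.abs_slope_le
  have hr0 : (0 : ℝ) ≤ r := Nat.cast_nonneg r
  have hmv : v.1 - m * v.2 = 0 := by rw [hm]; field_simp; ring
  set V : ℝ := (r + r ^ 2) ^ 2 with hV
  have hshift : ∀ p q, ζ (p + q) = ζ p + h * (q.1 - m * q.2) := by
    intro p q; rw [hζ, hζ]; simp only [Prod.fst_add, Prod.snd_add]; push_cast; ring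
  have hq : ∀ q ∈ stencilBox r, ((q.1 : ℝ) - m * q.2) ^ 2 ≤ V := by
    intro q hq
    obtain ⟨⟨a1, a2⟩, a3, a4⟩ := mem_stencilBox.1 hq
    have b1 : |(q.1 : ℝ)| ≤ r := abs_le.2 ⟨by exact_mod_cast a1, by exact_mod_cast a2⟩
    have b2 : |(q.2 : ℝ)| ≤ r := abs_le.2 ⟨by exact_mod_cast a3, by
      have : q.2 ≤ (r : ℤ) := by omega
      exact_mod_cast this⟩
    have b3 : |m * q.2| ≤ r ^ 2 := by
      rw [abs_mul, sq]; exact mul_le_mul hmr b2 (abs_nonneg _) hr0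
    rw [hV, ← sq_abs]
    have := abs_sub (q.1 : ℝ) (m * q.2)
    gcongr
    linarith
  -- The barrier is a supersolution: averaging `ζ²` adds at most `V h²`, since the linear part of
  -- the increment has mean zero, while `k` drops by at least one. The cone condition records the
  -- domain of dependence and is inherited by every pixel read.
  have key : ∀ k : ℕ, ∀ p : ℤ × ℤ, p.2 + r = k → 0 < k → p.2 ≤ p₀.2 →
      |p.1 - p₀.1| ≤ r * (p₀.2 - p.2) →
      |U p - c - β * ζ p| ≤ A + B * (ζ p ^ 2 + V * h ^ 2 * k) := by
    intro k
    induction k using Nat.strong_induction_on with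
    | _ k ih =>
    intro p hpk hk hp0 hcone
    by_cases hp : p.2 ≤ 0
    · refine (hbd p (by omega) hp hcone).trans ?_
      have : 0 ≤ V * h ^ 2 * k := by positivity
      nlinarith
    · push Not at hp
      have e1 : U p - c - β * ζ p
          = ∑ q ∈ stencilBox r, ρ q * (U (p + q) - c - β * ζ (p + q)) := by
        have e2 := hρ.sum_linear (c + β * ζ p) (β * h) (-(β * h * m))
        have e3 : ∑ q ∈ stencilBox r, ρ q * (U (p + q) - c - β * ζ (p + q))
            = ∑ q ∈ stencilBox r, ρ q * U (p + q) - ∑ q ∈ stencilBox r,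
              ρ q * (c + β * ζ p + β * h * q.1 + -(β * h * m) * q.2) := by
          rw [← Finset.sum_sub_distrib]
          exact Finset.sum_congr rfl fun q _ => by rw [hshift]; ring
        rw [e3, e2, ← hU p (by omega) (by omega)]
        linear_combination (β * h) * hmv
      rw [e1]
      have e4 : ∀ q ∈ stencilBox r, |U (p + q) - c - β * ζ (p + q)|
          ≤ (A + B * (ζ p ^ 2 + V * h ^ 2 * k)) + (2 * B * ζ p * h) * q.1
            + (-(2 * B * ζ p * h * m)) * q.2 := by
        intro q hqs
        obtain ⟨⟨a1, a2⟩, a3, a4⟩ := mem_stencilBox.1 hqs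
        have hlt : (k + q.2).toNat < k := by omega
        have hc : |(p + q).1 - p₀.1| ≤ r * (p₀.2 - (p + q).2) := by
          simp only [Prod.fst_add, Prod.snd_add]
          have f1 : |p.1 + q.1 - p₀.1| ≤ |p.1 - p₀.1| + |q.1| := by
            have := abs_add_le (p.1 - p₀.1) q.1
            rwa [show p.1 - p₀.1 + q.1 = p.1 + q.1 - p₀.1 by ring] at this
          have f2 : |q.1| ≤ r := abs_le.2 ⟨a1, a2⟩
          nlinarith
        have := ih _ hlt (p + q) (by simp only [Prod.snd_add]; omega) (by omega)
          (by simp only [Prod.snd_add]; omega) hc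
        refine this.trans ?_
        have hk2 : (((k + q.2).toNat : ℕ) : ℝ) ≤ k - 1 := by
          have : (((k + q.2).toNat : ℕ) : ℤ) ≤ k - 1 := by omega
          exact_mod_cast this
        rw [hshift]
        have g1 : h ^ 2 * ((q.1 : ℝ) - m * q.2) ^ 2 ≤ h ^ 2 * V :=
          mul_le_mul_of_nonneg_left (hq q hqs) (sq_nonneg h)
        have g2 : V * h ^ 2 * (((k + q.2).toNat : ℕ) : ℝ) ≤ V * h ^ 2 * (k - 1) :=
          mul_le_mul_of_nonneg_left hk2 (by positivity)
        have g3 := mul_le_mul_of_nonneg_left (add_le_add g1 g2) hB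
        linarith
      calc |∑ q ∈ stencilBox r, ρ q * (U (p + q) - c - β * ζ (p + q))|
          ≤ ∑ q ∈ stencilBox r, ρ q * |U (p + q) - c - β * ζ (p + q)| := by
            refine (Finset.abs_sum_le_sum_abs _ _).trans (Finset.sum_le_sum fun q _ => ?_)
            rw [abs_mul, abs_of_nonneg (hρ.nonneg q)]
        _ ≤ ∑ q ∈ stencilBox r, ρ q * ((A + B * (ζ p ^ 2 + V * h ^ 2 * k))
              + (2 * B * ζ p * h) * q.1 + (-(2 * B * ζ p * h * m)) * q.2) :=
            Finset.sum_le_sum fun q hq => mul_le_mul_of_nonneg_left (e4 q hq) (hρ.nonneg q)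
        _ = A + B * (ζ p ^ 2 + V * h ^ 2 * k) := by
            rw [hρ.sum_linear]; linear_combination (2 * B * ζ p * h) * hmv
  have hz : ζ p₀ = 0 := by rw [hζ]; ring
  have := key (p₀.2 + r).toNat p₀ (by omega) (by omega) le_rfl (by simp)
  rw [hz] at this
  simp only [mul_zero, sub_zero, ne_eq, OfNat.ofNat_ne_zero, not_false_eq_true, zero_pow,
    zero_add] at this
  refine this.trans ?_
  gcongr A + B * ?_
  -- There are at most `N (1 + r)` rows to descend; the factor `N` cancels one power of `h`.
  have hkN : (((p₀.2 + r).toNat : ℕ) : ℝ) ≤ N * (1 + r) := by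
    have e : (((p₀.2 + r).toNat : ℕ) : ℤ) ≤ N * (1 + r) := by
      have : (1 : ℤ) ≤ N := by omega
      have : (((p₀.2 + r).toNat : ℕ) : ℤ) = p₀.2 + r := by omega
      rw [this]; nlinarith [Int.natCast_nonneg r]
    exact_mod_cast e
  have hh0 : 0 ≤ h := by
    by_contra hneg
    push Not at hneg
    nlinarith [Nat.cast_nonneg (α := ℝ) N]
  calc V * h ^ 2 * (((p₀.2 + r).toNat : ℕ) : ℝ) ≤ V * h ^ 2 * (N * (1 + r)) := by gcongr
    _ = V * (1 + r) * h := by linear_combination V * h * (1 + r) * hh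

end IsStencil

/-! ### Linear interpolation -/

/-- Only the two nodes enclosing `t` carry a nonzero hat. The cases `F = 1` and `F m = m` give
reproduction of affine functions. -/
theorem sum_hat_mul {a b : ℤ} {t : ℝ} (ha : a ≤ t) (hb : t ≤ b) (F : ℤ → ℝ) :
    ∑ m ∈ Finset.Icc a b, max 0 (1 - |t - m|) * F m
      = (1 - Int.fract t) * F ⌊t⌋ + Int.fract t * F (⌊t⌋ + 1) := by
  have hfl : a ≤ ⌊t⌋ := Int.le_floor.2 ha
  have hfb : ⌊t⌋ ≤ b := by
    have : (⌊t⌋ : ℝ) ≤ b := (Int.floor_le t).trans hb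
    exact_mod_cast this
  have hf0 := Int.fract_nonneg t
  have hf1 := Int.fract_lt_one t
  have ht : t = ⌊t⌋ + Int.fract t := (Int.floor_add_fract t).symm
  -- For `⌊t⌋ = b` the node `⌊t⌋ + 1` leaves the range; its hat vanishes because `t ≤ b`.
  have hext : ∑ m ∈ Finset.Icc a b, max 0 (1 - |t - m|) * F m
      = ∑ m ∈ Finset.Icc a (b + 1), max 0 (1 - |t - m|) * F m := by
    refine Finset.sum_subset (Finset.Icc_subset_Icc le_rfl (by omega)) fun m hm hm' => ?_
    have : m = b + 1 := by simp at hm hm'; omega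
    subst this
    rw [max_eq_left, zero_mul]
    have : t - ((b + 1 : ℤ) : ℝ) ≤ -1 := by push_cast; linarith
    have := (le_abs_self (-(t - ((b + 1 : ℤ) : ℝ))))
    rw [abs_neg] at this
    linarith
  rw [hext, ← Finset.sum_subset (s₁ := {⌊t⌋, ⌊t⌋ + 1})]
  · rw [Finset.sum_pair (by omega)]
    have e1 : t - (⌊t⌋ : ℝ) = Int.fract t := by linarith
    have e2 : t - ((⌊t⌋ + 1 : ℤ) : ℝ) = -(1 - Int.fract t) := by push_cast; linarith
    rw [e1, e2, abs_of_nonneg hf0, abs_neg, abs_of_nonneg (by linarith), max_eq_right (by linarith),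
      max_eq_right (by linarith)]
    ring
  · intro m hm
    simp only [Finset.mem_insert, Finset.mem_singleton] at hm
    rw [Finset.mem_Icc]; omega
  · intro m _ hm'
    simp only [Finset.mem_insert, Finset.mem_singleton, not_or] at hm'
    rw [max_eq_left, zero_mul]
    rcases lt_or_gt_of_ne hm'.1 with h | h
    · have : (m : ℝ) + 1 ≤ ⌊t⌋ := by exact_mod_cast h
      have := le_abs_self (t - m)
      linarith
    · have h2 : ⌊t⌋ + 2 ≤ m := by omega
      have : (⌊t⌋ : ℝ) + 2 ≤ m := by exact_mod_cast h2
      have := neg_le_abs (t - m)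
      linarith

theorem sum_hat {a b : ℤ} {t : ℝ} (ha : a ≤ t) (hb : t ≤ b) :
    ∑ m ∈ Finset.Icc a b, max 0 (1 - |t - m|) = 1 := by
  simpa using sum_hat_mul ha hb fun _ => 1

theorem sum_hat_mul_self {a b : ℤ} {t : ℝ} (ha : a ≤ t) (hb : t ≤ b) :
    ∑ m ∈ Finset.Icc a b, max 0 (1 - |t - m|) * (m : ℝ) = t := by
  rw [sum_hat_mul ha hb fun m => (m : ℝ)]
  push_cast
  linarith [Int.floor_add_fract t]

theorem bilinearBasis_nonneg (h : ℝ) (q : ℤ × ℤ) (z : ℝ × ℝ) : 0 ≤ bilinearBasis h q z :=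
  mul_nonneg (le_max_left _ _) (le_max_left _ _)

theorem bilinearBasis_one (q : ℤ × ℤ) (y : ℝ × ℝ) :
    bilinearBasis 1 q y = max 0 (1 - |y.1 - q.1|) * max 0 (1 - |y.2 - q.2|) := by
  simp [bilinearBasis, pos]

/-- Points of the plane between the offsets of a stencil of radius `r`. -/
def stencilHull (r : ℕ) : Set (ℝ × ℝ) :=
  {y | (-(r : ℝ) ≤ y.1 ∧ y.1 ≤ r) ∧ -(r : ℝ) ≤ y.2 ∧ y.2 ≤ -1}

theorem sum_bilinearBasis {r : ℕ} {y : ℝ × ℝ} (hy : y ∈ stencilHull r) :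
    ∑ q ∈ stencilBox r, bilinearBasis 1 q y = 1 := by
  simp only [bilinearBasis_one, stencilBox, Finset.sum_product, ← Finset.mul_sum]
  rw [sum_hat (a := -(r : ℤ)) (b := -1) (by push_cast; exact hy.2.1) (by push_cast; exact hy.2.2)]
  simpa using sum_hat (a := -(r : ℤ)) (b := r) (by push_cast; exact hy.1.1)
    (by push_cast; exact hy.1.2)

theorem sum_bilinearBasis_mul_fst {r : ℕ} {y : ℝ × ℝ} (hy : y ∈ stencilHull r) :
    ∑ q ∈ stencilBox r, bilinearBasis 1 q y * q.1 = y.1 := by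
  simp only [bilinearBasis_one, stencilBox, Finset.sum_product]
  simp only [mul_right_comm _ _ (((_ : ℤ) : ℝ)), ← Finset.mul_sum]
  rw [sum_hat (a := -(r : ℤ)) (b := -1) (by push_cast; exact hy.2.1) (by push_cast; exact hy.2.2)]
  simpa using sum_hat_mul_self (a := -(r : ℤ)) (b := r) (by push_cast; exact hy.1.1)
    (by push_cast; exact hy.1.2)

theorem sum_bilinearBasis_mul_snd {r : ℕ} {y : ℝ × ℝ} (hy : y ∈ stencilHull r) :
    ∑ q ∈ stencilBox r, bilinearBasis 1 q y * q.2 = y.2 := by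
  simp only [bilinearBasis_one, stencilBox, Finset.sum_product]
  simp only [mul_assoc, ← Finset.mul_sum]
  rw [sum_hat_mul_self (a := -(r : ℤ)) (b := -1) (by push_cast; exact hy.2.1)
    (by push_cast; exact hy.2.2), ← Finset.sum_mul,
    sum_hat (a := -(r : ℤ)) (b := r) (by push_cast; exact hy.1.1) (by push_cast; exact hy.1.2),
    one_mul]

/-! ### The half-ball of readable neighbours -/

theorem eucl_nonneg (v : ℝ × ℝ) : 0 ≤ eucl v := Real.sqrt_nonneg _

theorem eucl_sq (v : ℝ × ℝ) : eucl v ^ 2 = v.1 ^ 2 + v.2 ^ 2 := Real.sq_sqrt (by positivity)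

theorem eucl_smul (c : ℝ) (v : ℝ × ℝ) : eucl (c • v) = |c| * eucl v := by
  simp only [eucl, Prod.smul_fst, Prod.smul_snd, smul_eq_mul]
  rw [← Real.sqrt_sq_eq_abs, ← Real.sqrt_mul (sq_nonneg c)]
  congr 1; ring

theorem abs_fst_le_eucl (v : ℝ × ℝ) : |v.1| ≤ eucl v := by
  rw [← Real.sqrt_sq_eq_abs]
  exact Real.sqrt_le_sqrt (by nlinarith [sq_nonneg v.2])

theorem abs_snd_le_eucl (v : ℝ × ℝ) : |v.2| ≤ eucl v := by
  rw [← Real.sqrt_sq_eq_abs]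
  exact Real.sqrt_le_sqrt (by nlinarith [sq_nonneg v.1])

theorem eucl_pos {v : ℝ × ℝ} (hv : v ≠ 0) : 0 < eucl v := by
  refine lt_of_le_of_ne (eucl_nonneg v) fun h => hv ?_
  have := eucl_sq v
  rw [← h] at this
  ext
  · simp; nlinarith [sq_nonneg v.1, sq_nonneg v.2]
  · simp; nlinarith [sq_nonneg v.1, sq_nonneg v.2]

theorem eucl_rotateTo (g y : ℝ × ℝ) : eucl (rotateTo g y) = eucl y := by
  unfold rotateTo
  split_ifs with hg
  · rfl
  · have h1 := eucl_pos hg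
    have h2 := eucl_sq g
    unfold eucl at *
    congr 1
    field_simp
    rw [h2]; ring

theorem rotateTo_smul (g : ℝ × ℝ) (c : ℝ) (y : ℝ × ℝ) :
    rotateTo g (c • y) = c • rotateTo g y := by
  unfold rotateTo
  split_ifs with hg
  · rfl
  · ext
    · simp; ring
    · simp; ring

/-- The rotation applied by a scheme to the lattice. -/
noncomputable def Scheme.rotation (s : Scheme) (g : ℝ × ℝ) (y : ℝ × ℝ) : ℝ × ℝ :=
  match s with
  | .coherenceTransport => y
  | .guidefill => rotateTo g y

theorem Scheme.eucl_rotation (s : Scheme) (g y : ℝ × ℝ) : eucl (s.rotation g y) = eucl y := by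
  cases s
  · rfl
  · exact eucl_rotateTo g y

theorem Scheme.rotation_smul (s : Scheme) (g : ℝ × ℝ) (c : ℝ) (y : ℝ × ℝ) :
    s.rotation g (c • y) = c • s.rotation g y := by
  cases s
  · rfl
  · exact rotateTo_smul g c y

theorem pos_eq_smul (h : ℝ) (q : ℤ × ℤ) : pos h q = h • pos 1 q := by
  ext <;> simp [pos, mul_comm]

theorem pos_add (h : ℝ) (p q : ℤ × ℤ) : pos h (p + q) = pos h p + pos h q := by
  ext <;> simp [pos, add_mul]

theorem mem_neighbourhood {s : Scheme} {Ω : Set (ℝ × ℝ)} {g : ℝ × ℝ} {h ε : ℝ} {p : ℤ × ℤ}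
    {z : ℝ × ℝ} : z ∈ neighbourhood s Ω g h ε (pos h p) ↔
      z ∈ Ω ∧ ∃ q, eucl (pos h q) ≤ ε ∧ z = pos h p + s.rotation g (pos h q) := by
  cases s
  · simp only [neighbourhood, Scheme.rotation, Set.mem_ofPred_eq]
    refine and_congr_right fun _ => ⟨?_, ?_⟩
    · rintro ⟨⟨q, rfl⟩, hq⟩
      have e : pos h q = pos h p + pos h (q - p) := by rw [← pos_add, add_sub_cancel]
      refine ⟨q - p, ?_, e⟩
      rwa [e, add_sub_cancel_left] at hq
    · rintro ⟨q, hq, rfl⟩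
      exact ⟨⟨p + q, (pos_add h p q).symm⟩, by rwa [add_sub_cancel_left]⟩
  · rfl

theorem mem_halfBall {s : Scheme} {g : ℝ × ℝ} {r : ℕ} {y : ℝ × ℝ} :
    y ∈ halfBall s g r ↔
      (∃ q, eucl (pos 1 q) ≤ r ∧ y = s.rotation g (pos 1 q)) ∧ y.2 ≤ -1 := by
  have e : (0 : ℝ × ℝ) = pos 1 0 := by ext <;> simp [pos]
  unfold halfBall
  rw [e, Set.mem_ofPred_eq, mem_neighbourhood, ← e]
  simp

theorem halfBall_subset_stencilHull (s : Scheme) (g : ℝ × ℝ) (r : ℕ) :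
    halfBall s g r ⊆ stencilHull r := by
  intro y hy
  obtain ⟨⟨q, hq, hyq⟩, h2⟩ := mem_halfBall.1 hy
  have he : eucl y ≤ r := by rwa [hyq, s.eucl_rotation]
  exact ⟨abs_le.1 ((abs_fst_le_eucl y).trans he),
    (abs_le.1 ((abs_snd_le_eucl y).trans he)).1, h2⟩

theorem finite_halfBall (s : Scheme) (g : ℝ × ℝ) (r : ℕ) : (halfBall s g r).Finite := by
  refine ((Finset.finite_toSet (Finset.Icc (-(r : ℤ)) r ×ˢ Finset.Icc (-(r : ℤ)) r)).image
    fun q => s.rotation g (pos 1 q)).subset ?_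
  intro y hy
  obtain ⟨⟨q, hq, rfl⟩, -⟩ := mem_halfBall.1 hy
  refine ⟨q, ?_, rfl⟩
  have h1 := (abs_fst_le_eucl (pos 1 q)).trans hq
  have h2 := (abs_snd_le_eucl (pos 1 q)).trans hq
  simp only [pos, mul_one] at h1 h2
  rw [abs_le] at h1 h2
  simp only [Finset.coe_product, Set.mem_prod, Finset.coe_Icc, Set.mem_Icc]
  exact ⟨⟨by exact_mod_cast h1.1, by exact_mod_cast h1.2⟩,
    by exact_mod_cast h2.1, by exact_mod_cast h2.2⟩

/-- The larger of `|g.1|` and `|g.2|` is at least `eucl g / 2`, so one of the rotated points `(±2,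
0)`, `(0, ±2)` has height at most `-1`. Radius `2` is enough for every rotation. -/
theorem halfBall_nonempty (s : Scheme) (g : ℝ × ℝ) {r : ℕ} (hr : 2 ≤ r) :
    (halfBall s g r).Nonempty := by
  have hr' : (2 : ℝ) ≤ r := by exact_mod_cast hr
  have key : ∀ q : ℤ × ℤ, q.1 ^ 2 + q.2 ^ 2 = 4 → (s.rotation g (pos 1 q)).2 ≤ -1 →
      (halfBall s g r).Nonempty := by
    intro q hq h2
    refine ⟨_, mem_halfBall.2 ⟨⟨q, ?_, rfl⟩, h2⟩⟩
    refine le_trans (Real.sqrt_le_iff.2 ⟨by norm_num, ?_⟩) hr'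
    have : ((q.1 : ℝ)) ^ 2 + (q.2 : ℝ) ^ 2 = 4 := by exact_mod_cast hq
    simp only [pos, mul_one]
    linarith
  cases s
  · exact key (0, -2) (by norm_num) (by simp [Scheme.rotation, pos])
  · by_cases hg : g = 0
    · exact key (0, -2) (by norm_num) (by simp [Scheme.rotation, pos, rotateTo, hg])
    · have h1 := eucl_pos hg
      have h2 := eucl_sq g
      have h3 : eucl g ≤ 2 * g.1 ∨ eucl g ≤ 2 * -g.1 ∨ eucl g ≤ 2 * g.2 ∨ eucl g ≤ 2 * -g.2 := by
        by_contra! hcon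
        obtain ⟨c1, c2, c3, c4⟩ := hcon
        nlinarith
      simp only [Scheme.rotation, rotateTo, if_neg hg, pos] at key
      rcases h3 with h3 | h3 | h3 | h3
      · refine key (2, 0) (by norm_num) ?_
        rw [div_le_iff₀ h1]; push_cast; linarith
      · refine key (-2, 0) (by norm_num) ?_
        rw [div_le_iff₀ h1]; push_cast; linarith
      · refine key (0, -2) (by norm_num) ?_
        rw [div_le_iff₀ h1]; push_cast; linarith
      · refine key (0, 2) (by norm_num) ?_
        rw [div_le_iff₀ h1]; push_cast; linarith

theorem weight_nonneg (μ : ℝ) (g : ℝ × ℝ) (ε : ℝ) (x y : ℝ × ℝ) : 0 ≤ weight μ g ε x y :=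
  mul_nonneg (div_nonneg zero_le_one (eucl_nonneg _)) (Real.exp_pos _).le

theorem weight_pos (μ : ℝ) (g : ℝ × ℝ) (ε : ℝ) {x y : ℝ × ℝ} (h : y ≠ x) :
    0 < weight μ g ε x y :=
  mul_pos (div_pos one_pos (eucl_pos (sub_ne_zero.2 h))) (Real.exp_pos _)

/-- The Gaussian factor is scale invariant; the factor `h⁻¹` comes from the inverse distance and
cancels on normalisation. -/
theorem weight_scale (μ : ℝ) (g : ℝ × ℝ) (ε : ℝ) {h : ℝ} (hh : 0 < h) (x y : ℝ × ℝ) :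
    weight μ g (ε * h) x (x + h • y) = h⁻¹ * weight μ g ε 0 y := by
  simp only [weight, add_sub_cancel_left, sub_zero, eucl_smul, abs_of_pos hh, Prod.smul_fst,
    Prod.smul_snd, smul_eq_mul]
  have e : -(μ ^ 2 / (2 * (ε * h) ^ 2)) * ((perp g).1 * (h * y.1) + (perp g).2 * (h * y.2)) ^ 2
      = -(μ ^ 2 / (2 * ε ^ 2)) * ((perp g).1 * y.1 + (perp g).2 * y.2) ^ 2 := by
    by_cases hε : ε = 0
    · simp [hε]
    · field_simp
  rw [e]
  simp only [one_div, mul_inv]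
  ring

/-! ### The stencil of one step of the algorithm -/

/-- The total weight of the half-ball. -/
noncomputable def totalWeight (s : Scheme) (g : ℝ × ℝ) (μ : ℝ) (r : ℕ) : ℝ :=
  ∑ y ∈ (finite_halfBall s g r).toFinset, weight μ g r 0 y

/-- The weight with which a pixel at a given offset enters a filled value, after the bilinear
interpolation is expanded. -/
noncomputable def stencilWeight (s : Scheme) (g : ℝ × ℝ) (μ : ℝ) (r : ℕ) (q : ℤ × ℤ) : ℝ :=
  (totalWeight s g μ r)⁻¹ *
    ∑ y ∈ (finite_halfBall s g r).toFinset, weight μ g r 0 y * bilinearBasis 1 q y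

theorem totalWeight_pos (s : Scheme) (g : ℝ × ℝ) (μ : ℝ) {r : ℕ} (hr : 2 ≤ r) :
    0 < totalWeight s g μ r := by
  refine Finset.sum_pos (fun y hy => weight_pos _ _ _ ?_) ?_
  · rintro rfl
    have := (mem_halfBall.1 ((finite_halfBall s g r).mem_toFinset.1 hy)).2
    norm_num at this
  · simpa using halfBall_nonempty s g hr

theorem sum_stencilWeight_mul (s : Scheme) (g : ℝ × ℝ) (μ : ℝ) (r : ℕ) (F : ℤ × ℤ → ℝ)
    (G : ℝ × ℝ → ℝ)
    (hG : ∀ y ∈ stencilHull r, ∑ q ∈ stencilBox r, bilinearBasis 1 q y * F q = G y) :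
    ∑ q ∈ stencilBox r, stencilWeight s g μ r q * F q
      = (totalWeight s g μ r)⁻¹ *
        ∑ y ∈ (finite_halfBall s g r).toFinset, weight μ g r 0 y * G y := by
  simp only [stencilWeight, mul_assoc, ← Finset.mul_sum, Finset.sum_mul]
  rw [Finset.sum_comm]
  congr 1
  refine Finset.sum_congr rfl fun y hy => ?_
  rw [← Finset.mul_sum]
  rw [hG y (halfBall_subset_stencilHull s g r ((finite_halfBall s g r).mem_toFinset.1 hy))]

theorem transportDirection_eq (s : Scheme) (g : ℝ × ℝ) (μ : ℝ) (r : ℕ) :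
    transportDirection s g μ r = (totalWeight s g μ r)⁻¹ •
      ∑ y ∈ (finite_halfBall s g r).toFinset, weight μ g r 0 y • y := by
  simp only [transportDirection, totalWeight,
    finsum_mem_eq_finite_toFinset_sum _ (finite_halfBall s g r)]

/-- Interpolation spreads the mass of each half-ball point over nearby pixels without changing its
total or its centre, so the mean is still `g*`. -/
theorem isStencil_stencilWeight (s : Scheme) (g : ℝ × ℝ) (μ : ℝ) {r : ℕ} (hr : 2 ≤ r) :
    IsStencil r (stencilWeight s g μ r) (transportDirection s g μ r) where
  nonneg q := mul_nonneg (inv_nonneg.2 (totalWeight_pos s g μ hr).le)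
    (Finset.sum_nonneg fun y _ => mul_nonneg (weight_nonneg _ _ _ _ _)
      (bilinearBasis_nonneg _ _ _))
  sum_eq_one := by
    have := sum_stencilWeight_mul s g μ r (fun _ => 1) (fun _ => 1)
      (fun y hy => by simpa using sum_bilinearBasis hy)
    simp only [mul_one] at this
    rw [this]
    exact inv_mul_cancel₀ (totalWeight_pos s g μ hr).ne'
  sum_fst := by
    rw [sum_stencilWeight_mul s g μ r (fun q => q.1) (fun y => y.1)
      (fun y hy => sum_bilinearBasis_mul_fst hy), transportDirection_eq]
    simp [Prod.fst_sum]
  sum_snd := by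
    rw [sum_stencilWeight_mul s g μ r (fun q => q.2) (fun y => y.2)
      (fun y hy => sum_bilinearBasis_mul_snd hy), transportDirection_eq]
    simp [Prod.snd_sum]

/-- The pixel rows `k < j ≤ N`. -/
def rowsAbove (N k : ℕ) : Set (ℤ × ℤ) := {q | (k : ℤ) < q.2 ∧ q.2 ≤ N}

/-! ### The shells are pixel rows, and each fill is a stencil average -/

section Step

variable {δ h : ℝ} {N r k : ℕ}

theorem pixelsIn_inpaintingDomain (hh : h * N = 1) (h0 : 0 < h) :
    pixelsIn inpaintingDomain h = rowsAbove N 0 := by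
  ext q
  simp only [pixelsIn, inpaintingDomain, pos, rowsAbove, Set.mem_ofPred_eq, Nat.cast_zero]
  refine and_congr ?_ ?_
  · rw [mul_pos_iff_of_pos_right h0, Int.cast_pos]
  · rw [← hh, mul_comm h, mul_le_mul_iff_left₀ h0]
    exact_mod_cast Iff.rfl

theorem pos_mem_imageDomain (hh : h * N = 1) (h0 : 0 < h) (hδ : r * h < δ) {q : ℤ × ℤ}
    (h1 : -(r : ℤ) ≤ q.2) (h2 : q.2 ≤ N) : pos h q ∈ imageDomain δ := by
  have e1 : -(r : ℝ) ≤ q.2 := by exact_mod_cast h1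
  have e2 : (q.2 : ℝ) ≤ N := by exact_mod_cast h2
  simp only [imageDomain, pos, Set.mem_ofPred_eq]
  constructor <;> nlinarith

/-- Rows above `N` lie outside the image, so a readable neighbour can only come from row `k` or
below. -/
theorem activeBoundary_rowsAbove (hh : h * N = 1) (h0 : 0 < h) (hδ : r * h < δ) :
    activeBoundary (imageDomain δ) h (rowsAbove N k) = {q : ℤ × ℤ | q.2 = (k : ℤ) + 1 ∧ q.2 ≤ (N : ℤ)} := by
  ext q
  simp only [activeBoundary, innerBoundary, rowsAbove, eightNeighbours, Set.mem_ofPred_eq]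
  constructor
  · rintro ⟨⟨⟨h1, h2⟩, -⟩, q', ⟨-, -, h3⟩, h4, h5⟩
    refine ⟨?_, h2⟩
    simp only [pixelsIn, imageDomain, pos, Set.mem_ofPred_eq] at h4
    have h6 : q'.2 ≤ N := by
      have : (q'.2 : ℝ) * h ≤ N * h := by rw [mul_comm (N : ℝ), hh]; exact h4.2
      exact_mod_cast le_of_mul_le_mul_right this h0
    simp only [Set.mem_ofPred_eq, not_and_or, not_lt, not_le] at h5
    rw [abs_le] at h3
    omega
  · rintro ⟨h1, h2⟩
    have hn : (q.1, q.2 - 1) ∈ {q' : ℤ × ℤ | q' ≠ q ∧ |q'.1 - q.1| ≤ 1 ∧ |q'.2 - q.2| ≤ 1} := by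
      refine ⟨fun e => ?_, by simp, by simp⟩
      have := congrArg Prod.snd e
      simp at this
    have hr : (q.1, q.2 - 1) ∉ {q : ℤ × ℤ | (k : ℤ) < q.2 ∧ q.2 ≤ N} := by
      simp only [Set.mem_ofPred_eq]; omega
    exact ⟨⟨⟨by omega, h2⟩, _, hn, hr⟩, _, hn,
      pos_mem_imageDomain hh h0 hδ (by simp only; omega) (by simp only; omega), hr⟩

/-- The open buffer of width `h` around row `k + 1` stops just short of height `k h`. Conversely,
rounding the column and taking the ceiling of the row finds a remaining pixel within `h`; that row
is at most `N` because `z.2 ≤ 1`. -/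
theorem mem_continuousRegion_rowsAbove (hh : h * N = 1) (h0 : 0 < h) {z : ℝ × ℝ}
    (hz : z ∈ imageDomain δ) :
    z ∈ continuousRegion (imageDomain δ) h (rowsAbove N k) ↔ k * h < z.2 := by
  simp only [continuousRegion, rowsAbove, Set.mem_ofPred_eq, hz, true_and]
  constructor
  · rintro ⟨q, ⟨h1, h2⟩, h3⟩
    have h4 := (norm_snd_le (pos h q - z)).trans_lt h3
    simp only [Prod.snd_sub, pos, Real.norm_eq_abs, abs_lt] at h4
    have h5 : (k : ℝ) + 1 ≤ q.2 := by exact_mod_cast h1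
    nlinarith
  · intro hk
    refine ⟨(round (z.1 / h), ⌈z.2 / h⌉), ⟨?_, ?_⟩, ?_⟩
    · have : (k : ℝ) < z.2 / h := by rwa [lt_div_iff₀ h0]
      have := this.trans_le (Int.le_ceil _)
      exact_mod_cast this
    · rw [Int.ceil_le, div_le_iff₀ h0, Int.cast_natCast, mul_comm, hh]
      exact hz.2
    · rw [Prod.norm_def, max_lt_iff]
      simp only [pos, Prod.fst_sub, Prod.snd_sub, Real.norm_eq_abs]
      constructor
      · have e := abs_sub_round (z.1 / h)
        have : (round (z.1 / h) : ℝ) * h - z.1 = -(z.1 / h - round (z.1 / h)) * h := by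
          field_simp; ring
        rw [this, abs_mul, abs_neg, abs_of_pos h0]
        nlinarith
      · have e1 := Int.le_ceil (z.2 / h)
        have e2 := Int.ceil_lt_add_one (z.2 / h)
        rw [div_le_iff₀ h0] at e1
        rw [← sub_lt_iff_lt_add, lt_div_iff₀ h0] at e2
        rw [abs_lt]
        constructor <;> nlinarith

/-- From row `k + 1`, lying at height at most `k h` means descending at least `h`, which is the
condition `y.2 ≤ -1`. The bound `r * h < δ` keeps the bottom of the half-ball inside the image. -/
theorem readable_neighbours (s : Scheme) (g : ℝ × ℝ) (hh : h * N = 1) (h0 : 0 < h)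
    (hδ : r * h < δ) {p : ℤ × ℤ} (hp : p.2 = k + 1) (hpN : p.2 ≤ N) :
    neighbourhood s (imageDomain δ) g h (r * h) (pos h p) ∩
        (imageDomain δ \ continuousRegion (imageDomain δ) h (rowsAbove N k))
      = (fun y => pos h p + h • y) '' halfBall s g r := by
  have hpos2 : (pos h p).2 = (k + 1) * h := by
    simp only [pos, hp]; push_cast; ring
  have hkN : ((k : ℝ) + 1) * h ≤ 1 := by
    have : ((k : ℝ) + 1) ≤ N := by rw [hp] at hpN; exact_mod_cast hpN
    nlinarith
  ext z
  simp only [Set.mem_inter_iff, mem_neighbourhood, Set.mem_sdiff, Set.mem_image, mem_halfBall]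
  constructor
  · rintro ⟨⟨hz, q, hq, rfl⟩, -, hc⟩
    rw [mem_continuousRegion_rowsAbove hh h0 hz, not_lt] at hc
    rw [pos_eq_smul h q, eucl_smul, abs_of_pos h0, mul_comm, mul_le_mul_iff_left₀ h0] at hq
    rw [pos_eq_smul h q, s.rotation_smul] at hc ⊢
    refine ⟨_, ⟨⟨q, hq, rfl⟩, ?_⟩, rfl⟩
    simp only [Prod.snd_add, Prod.smul_snd, smul_eq_mul, hpos2] at hc
    nlinarith
  · rintro ⟨y, ⟨⟨q, hq, rfl⟩, h2⟩, rfl⟩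
    set y := s.rotation g (pos 1 q) with hy
    have hyr : -(r : ℝ) ≤ y.2 := by
      have := (abs_snd_le_eucl y).trans (b := eucl y) le_rfl
      rw [hy, s.eucl_rotation] at this
      exact (abs_le.1 (this.trans hq)).1
    have e2 : (pos h p + h • y).2 = (k + 1) * h + h * y.2 := by
      simp only [Prod.snd_add, Prod.smul_snd, smul_eq_mul, hpos2]
    have hz : pos h p + h • y ∈ imageDomain δ := by
      simp only [imageDomain, Set.mem_ofPred_eq, e2]
      constructor <;> nlinarith [Nat.cast_nonneg (α := ℝ) k]
    refine ⟨⟨hz, q, ?_, ?_⟩, hz, ?_⟩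
    · rw [pos_eq_smul h q, eucl_smul, abs_of_pos h0, mul_comm]
      gcongr
    · rw [pos_eq_smul h q, s.rotation_smul]
    · rw [mem_continuousRegion_rowsAbove hh h0 hz, e2, not_lt]
      nlinarith

theorem bilinearBasis_scale (h0 : 0 < h) (p q : ℤ × ℤ) (y : ℝ × ℝ) :
    bilinearBasis h (p + q) (pos h p + h • y) = bilinearBasis 1 q y := by
  have e : ∀ (a b : ℤ) (t : ℝ), |(a : ℝ) * h + h * t - ((a + b : ℤ) : ℝ) * h| / h = |t - b| := by
    intro a b t
    rw [div_eq_iff h0.ne', ← abs_of_pos h0, ← abs_mul, abs_of_pos h0]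
    congr 1; push_cast; ring
  rw [bilinearBasis_one]
  simp only [bilinearBasis, pos, Prod.fst_add, Prod.snd_add, Prod.smul_fst, Prod.smul_snd,
    smul_eq_mul, e]

/-- The hull has integer sides, so a pixel whose hat is nonzero at `y` stays within the box; in
particular no value from the row being filled is read. -/
theorem interpolate_eq_sum {d : ℕ} (hh : h * N = 1) (h0 : 0 < h) (hδ : r * h < δ) {p : ℤ × ℤ}
    (hp : 1 ≤ p.2) (hpN : p.2 ≤ N) (u : ℤ × ℤ → Fin d → ℝ) {y : ℝ × ℝ}
    (hy : y ∈ stencilHull r) :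
    interpolate (imageDomain δ) h u (pos h p + h • y)
      = ∑ q ∈ stencilBox r, bilinearBasis 1 q y • u (p + q) := by
  classical
  have hinj : Function.Injective fun q : ℤ × ℤ => p + q := add_right_injective p
  rw [interpolate, finsum_mem_eq_sum_of_inter_support_eq _ (t := (stencilBox r).map ⟨_, hinj⟩),
    Finset.sum_map]
  · exact Finset.sum_congr rfl fun q _ => by
      simp only [Function.Embedding.coeFn_mk, bilinearBasis_scale h0]
  · ext q'
    obtain ⟨q, rfl⟩ : ∃ q, q' = p + q := ⟨q' - p, by abel⟩
    simp only [Set.mem_inter_iff, Function.mem_support, bilinearBasis_scale h0,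
      Finset.coe_map, Function.Embedding.coeFn_mk, hinj.mem_set_image, Finset.mem_coe]
    refine and_congr_left fun hne => ?_
    have hb : bilinearBasis 1 q y ≠ 0 := fun e => hne (by rw [e, zero_smul])
    rw [bilinearBasis_one] at hb
    have hpos : ∀ t : ℝ, max 0 (1 - |t|) ≠ 0 → |t| < 1 := by
      intro t ht
      by_contra hcon
      exact ht (max_eq_left (by linarith))
    have h1 := abs_lt.1 (hpos _ (left_ne_zero_of_mul hb))
    have h2 := abs_lt.1 (hpos _ (right_ne_zero_of_mul hb))
    have hq : q ∈ stencilBox r := by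
      obtain ⟨⟨y1, y2⟩, y3, y4⟩ := hy
      have a1 : -(r : ℝ) - 1 < q.1 := by linarith
      have a2 : (q.1 : ℝ) < r + 1 := by linarith
      have a3 : -(r : ℝ) - 1 < q.2 := by linarith
      have a4 : (q.2 : ℝ) < 0 := by linarith
      have b1 : -(r : ℤ) - 1 < q.1 := by exact_mod_cast a1
      have b2 : q.1 < (r : ℤ) + 1 := by exact_mod_cast a2
      have b3 : -(r : ℤ) - 1 < q.2 := by exact_mod_cast a3
      have b4 : q.2 < 0 := by exact_mod_cast a4
      rw [mem_stencilBox]; omega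
    refine ⟨fun _ => hq, fun _ => ?_⟩
    have := mem_stencilBox.1 hq
    exact pos_mem_imageDomain hh h0 hδ (by simp only [Prod.snd_add]; omega)
      (by simp only [Prod.snd_add]; omega)

theorem fillValue_eq_sum {d : ℕ} (s : Scheme) (g : ℝ × ℝ) (μ : ℝ) (hh : h * N = 1) (h0 : 0 < h)
    (hδ : r * h < δ) {S : State d} (hS : S.region = rowsAbove N k) {p : ℤ × ℤ}
    (hp : p.2 = k + 1) (hpN : p.2 ≤ N) :
    fillValue (imageDomain δ) h (neighbourhood s (imageDomain δ) g h (r * h))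
        (weight μ g (r * h)) S (pos h p)
      = ∑ q ∈ stencilBox r, stencilWeight s g μ r q • S.image (p + q) := by
  have hinj : Function.Injective fun y : ℝ × ℝ => pos h p + h • y := by
    intro a b hab
    exact smul_right_injective _ h0.ne' (add_left_cancel hab)
  have hfin := finite_halfBall s g r
  unfold fillValue
  rw [hS, readable_neighbours s g hh h0 hδ hp hpN, finsum_mem_image hinj.injOn,
    finsum_mem_image hinj.injOn, finsum_mem_eq_finite_toFinset_sum _ hfin,
    finsum_mem_eq_finite_toFinset_sum _ hfin]
  simp only [weight_scale μ g _ h0, ← Finset.mul_sum]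
  have e1 : ∑ y ∈ hfin.toFinset, (h⁻¹ * weight μ g r 0 y) •
        interpolate (imageDomain δ) h S.image (pos h p + h • y)
      = h⁻¹ • ∑ q ∈ stencilBox r, (∑ y ∈ hfin.toFinset,
        weight μ g r 0 y * bilinearBasis 1 q y) • S.image (p + q) := by
    simp only [Finset.sum_smul]
    rw [Finset.sum_comm, Finset.smul_sum]
    refine Finset.sum_congr rfl fun y hy => ?_
    rw [interpolate_eq_sum hh h0 hδ (by omega) hpN _
      (halfBall_subset_stencilHull s g r (hfin.mem_toFinset.1 hy)), mul_smul, Finset.smul_sum]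
    simp only [smul_smul]
  rw [e1, smul_smul, mul_inv, inv_inv, mul_right_comm, mul_inv_cancel₀ h0.ne', one_mul,
    Finset.smul_sum]
  exact Finset.sum_congr rfl fun q _ => by rw [smul_smul]; rfl

/-- Filled rows are never overwritten and a stencil reads only lower rows, so the averaging identity
that holds when a row is filled persists in all later states. -/
theorem stateAfter_spec {d : ℕ} (s : Scheme) (u₀ : ℝ × ℝ → Fin d → ℝ) (g : ℝ × ℝ) (μ : ℝ)
    (hh : h * N = 1) (h0 : 0 < h) (hδ : r * h < δ) (k : ℕ) :
    (stateAfter s δ u₀ g μ r h k).region = rowsAbove N k ∧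
    (∀ p : ℤ × ℤ, p.2 ≤ 0 → (stateAfter s δ u₀ g μ r h k).image p = u₀ (pos h p)) ∧
    ∀ p : ℤ × ℤ, 1 ≤ p.2 → p.2 ≤ N → p.2 ≤ k → (stateAfter s δ u₀ g μ r h k).image p
      = ∑ q ∈ stencilBox r, stencilWeight s g μ r q •
        (stateAfter s δ u₀ g μ r h k).image (p + q) := by
  induction k with
  | zero =>
    refine ⟨pixelsIn_inpaintingDomain hh h0, fun p hp => ?_, fun p h1 _ h2 => ?_⟩
    · simp only [stateAfter, Function.iterate_zero, id_eq, initialState]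
      rw [if_neg]
      rw [pixelsIn_inpaintingDomain hh h0]
      simp only [rowsAbove, Set.mem_ofPred_eq]
      push_cast; omega
    · push_cast at h2; omega
  | succ k ih =>
    obtain ⟨ih1, ih2, ih3⟩ := ih
    have hstep : stateAfter s δ u₀ g μ r h (k + 1)
        = fillShell (imageDomain δ) h (neighbourhood s (imageDomain δ) g h (r * h))
          (weight μ g (r * h)) (stateAfter s δ u₀ g μ r h k) := by
      simp only [stateAfter, Function.iterate_succ_apply']
    set S := stateAfter s δ u₀ g μ r h k with hSdef
    have hact : activeBoundary (imageDomain δ) h S.region = {q : ℤ × ℤ | q.2 = (k : ℤ) + 1 ∧ q.2 ≤ (N : ℤ)} := by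
      rw [ih1, activeBoundary_rowsAbove hh h0 hδ]
    have hold : ∀ p : ℤ × ℤ, p.2 ≤ k → (stateAfter s δ u₀ g μ r h (k + 1)).image p = S.image p := by
      intro p hp
      simp only [hstep, fillShell, hact]
      rw [if_neg]
      simp only [Set.mem_ofPred_eq]; omega
    have hlow : ∀ p : ℤ × ℤ, p.2 ≤ k + 1 → ∑ q ∈ stencilBox r, stencilWeight s g μ r q •
        (stateAfter s δ u₀ g μ r h (k + 1)).image (p + q)
        = ∑ q ∈ stencilBox r, stencilWeight s g μ r q • S.image (p + q) := by
      intro p hp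
      refine Finset.sum_congr rfl fun q hq => ?_
      have := mem_stencilBox.1 hq
      rw [hold (p + q) (by simp only [Prod.snd_add]; omega)]
    refine ⟨?_, fun p hp => ?_, fun p h1 h2 h3 => ?_⟩
    · simp only [hstep, fillShell, hact]
      rw [ih1]
      ext q
      simp only [rowsAbove, Set.mem_sdiff, Set.mem_ofPred_eq]
      push_cast; omega
    · rw [hold p (by omega), ih2 p hp]
    · push_cast at h3
      rw [hlow p h3]
      by_cases hpk : p.2 ≤ k
      · rw [hold p hpk, ih3 p h1 h2 hpk]
      · have hpe : p.2 = k + 1 := by omega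
        rw [← fillValue_eq_sum s g μ hh h0 hδ ih1 hpe h2]
        simp only [hstep, fillShell, hact]
        rw [if_pos (show p ∈ {q : ℤ × ℤ | q.2 = (k : ℤ) + 1 ∧ q.2 ≤ (N : ℤ)} from ⟨hpe, h2⟩)]

theorem exists_region_eq_empty {d : ℕ} (s : Scheme) (u₀ : ℝ × ℝ → Fin d → ℝ) (g : ℝ × ℝ) (μ : ℝ)
    (hh : h * N = 1) (h0 : 0 < h) (hδ : r * h < δ) :
    ∃ k, (stateAfter s δ u₀ g μ r h k).region = ∅ := by
  refine ⟨N, ?_⟩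
  rw [(stateAfter_spec s u₀ g μ hh h0 hδ N).1]
  ext q
  simp only [rowsAbove, Set.mem_ofPred_eq, Set.mem_empty_iff_false, iff_false]
  omega

theorem inpainted_spec {d : ℕ} (s : Scheme) (u₀ : ℝ × ℝ → Fin d → ℝ) (g : ℝ × ℝ) (μ : ℝ)
    (hh : h * N = 1) (h0 : 0 < h) (hδ : r * h < δ) (c : Fin d) :
    (∀ p : ℤ × ℤ, p.2 ≤ 0 → inpainted s δ u₀ g μ r h p c = u₀ (pos h p) c) ∧
    ∀ p : ℤ × ℤ, 1 ≤ p.2 → p.2 ≤ N → inpainted s δ u₀ g μ r h p c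
      = ∑ q ∈ stencilBox r, stencilWeight s g μ r q * inpainted s δ u₀ g μ r h (p + q) c := by
  unfold inpainted
  set k := sInf {k | (stateAfter s δ u₀ g μ r h k).region = ∅} with hk
  have hmem : (stateAfter s δ u₀ g μ r h k).region = ∅ :=
    Nat.sInf_mem (exists_region_eq_empty s u₀ g μ hh h0 hδ)
  obtain ⟨h1, h2, h3⟩ := stateAfter_spec s u₀ g μ hh h0 hδ k
  -- While `k < N` the pixel `(0, N)` is still unfilled, so the terminal state includes all `N`
  -- rows.
  have hNk : N ≤ k := by
    by_contra hcon
    have : ((0 : ℤ), (N : ℤ)) ∈ rowsAbove N k := by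
      simp only [rowsAbove, Set.mem_ofPred_eq]; omega
    rw [← h1, hmem] at this
    exact this
  refine ⟨fun p hp => by rw [h2 p hp], fun p hp hpN => ?_⟩
  rw [h3 p hp hpN (by omega)]
  simp [Finset.sum_apply]

end Step

/-! ### Boundary data -/

/-- The curve stays below `y = 0` but reaches it at `a` with positive slope, so `a` is the right end
of the interval. Near `a`, `f` descends at least at half that slope. Farther away, monotonicity
keeps the curve below height `-η`. -/
theorem JumpCurve.exists_cone {δ : ℝ} (γ : JumpCurve δ) :
    ∃ a η κ : ℝ, 0 < η ∧ 0 ≤ κ ∧ ∀ x ∈ γ.interval, -η ≤ γ.f x → |x - a| ≤ κ * |γ.f x| := by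
  obtain ⟨a, ha, hfa, hpos⟩ := γ.meets
  set D := derivWithin γ.f γ.interval a with hD
  have hder : HasDerivWithinAt γ.f D γ.interval a :=
    (differentiableWithinAt_of_derivWithin_ne_zero hpos.ne').hasDerivWithinAt
  have hev := hder.isLittleO.def (half_pos hpos)
  rw [eventually_nhdsWithin_iff, Metric.eventually_nhds_iff] at hev
  obtain ⟨τ, hτ, hev⟩ := hev
  have hlin : ∀ x ∈ γ.interval, |x - a| < τ → |γ.f x - (x - a) * D| ≤ D / 2 * |x - a| := by
    intro x hx hxa
    have := hev (by rwa [Real.dist_eq]) hx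
    simpa [hfa] using this
  have hright : ∀ x ∈ γ.interval, x ≤ a := by
    intro x hx
    by_contra hcon
    push Not at hcon
    set x1 := min x (a + τ / 2) with hx1
    have h1 : a < x1 := lt_min hcon (by linarith)
    have h2 : x1 ∈ γ.interval := γ.ordConnected.out ha hx ⟨h1.le, min_le_left _ _⟩
    have h3 : x1 ≤ a + τ / 2 := min_le_right _ _
    have h4 := hlin x1 h2 (by rw [abs_of_pos (by linarith)]; linarith)
    rw [abs_of_pos (show 0 < x1 - a by linarith)] at h4
    have h5 := (γ.mapsTo h2).2
    have h6 := (abs_le.1 h4).1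
    nlinarith [mul_pos hpos (sub_pos.2 h1)]
  have hleft : ∀ x ∈ γ.interval, |x - a| < τ → γ.f x ≤ -(D / 2 * |x - a|) := by
    intro x hx hxa
    have h4 := (abs_le.1 (hlin x hx hxa)).2
    rw [abs_of_nonpos (by linarith [hright x hx])] at h4 ⊢
    linarith
  refine ⟨a, D * τ / 8, 2 / D, by positivity, by positivity, fun x hx hfx => ?_⟩
  by_cases hxa : |x - a| < τ
  · have h1 := hleft x hx hxa
    rw [abs_of_nonpos (γ.mapsTo hx).2, div_mul_eq_mul_div, le_div_iff₀ hpos]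
    linarith
  · exfalso
    push Not at hxa
    have hle := hright x hx
    rw [abs_of_nonpos (by linarith)] at hxa
    have h2 : a - τ / 2 ∈ γ.interval := γ.ordConnected.out hx ha ⟨by linarith, by linarith⟩
    have e : |a - τ / 2 - a| = τ / 2 := by
      rw [show a - τ / 2 - a = -(τ / 2) by ring, abs_neg, abs_of_pos (by linarith)]
    have h3 := hleft _ h2 (by rw [e]; linarith)
    rw [e] at h3
    have h4 := γ.monotone hx h2 (by linarith)
    nlinarith [mul_pos hpos hτ]

/-- Near the line `y = 0` the jump set lies in finitely many cones with apex on that line. -/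
theorem exists_jump_cones {δ : ℝ} {n : ℕ} (C : Fin n → JumpCurve δ) (B : ℝ) :
    ∃ (T : Finset ℝ) (η κ : ℝ), 0 < η ∧ 0 ≤ κ ∧ ∀ x y : ℝ, |x| ≤ B → -η ≤ y →
      (x, y) ∈ jumpSet C → ∃ a ∈ T, |x - a| ≤ κ * |y| := by
  choose a η κ hη hκ hcone using fun i => (C i).exists_cone
  -- A common height for all curves, which also covers an empty family; `η₀ ≤ 1` makes each cone at
  -- most `κ₀` wide to either side.
  obtain ⟨η₀, hη₀, hη₁, hηle⟩ : ∃ η₀ : ℝ, 0 < η₀ ∧ η₀ ≤ 1 ∧ ∀ i, η₀ ≤ η i := by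
    have h1 : ∀ᶠ t : ℝ in nhdsWithin 0 (Set.Ioi 0), ∀ i, t ≤ η i :=
      Filter.eventually_all.2 fun i =>
        (eventually_nhdsWithin_of_eventually_nhds (eventually_le_nhds (hη i)))
    have h2 : ∀ᶠ t : ℝ in nhdsWithin 0 (Set.Ioi 0), t ≤ 1 :=
      eventually_nhdsWithin_of_eventually_nhds (eventually_le_nhds one_pos)
    obtain ⟨t, ⟨ht1, ht2⟩, ht3⟩ := ((h1.and h2).and self_mem_nhdsWithin).exists
    exact ⟨t, ht3, ht2, ht1⟩
  set κ₀ := ∑ i, κ i with hκ₀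
  have hκle : ∀ i, κ i ≤ κ₀ := fun i =>
    Finset.single_le_sum (f := κ) (fun j _ => hκ j) (Finset.mem_univ i)
  have hκ₀0 : 0 ≤ κ₀ := Finset.sum_nonneg fun j _ => hκ j
  have hale : ∀ i, |a i| ≤ ∑ j, |a j| := fun i =>
    Finset.single_le_sum (f := fun j => |a j|) (fun j _ => abs_nonneg _) (Finset.mem_univ i)
  -- Only translates with `|m| ≤ R` can bring a cone into `|x| ≤ B`, so finitely many apices
  -- suffice.
  set R : ℤ := ⌈B + κ₀ + ∑ j, |a j|⌉ with hR
  refine ⟨(Finset.univ ×ˢ Finset.Icc (-R) R).image fun im => a im.1 + (im.2 : ℝ),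
    η₀, κ₀, hη₀, hκ₀0, ?_⟩
  rintro x y hx hy ⟨i, t, ht, m, hm⟩
  obtain ⟨rfl, rfl⟩ := Prod.mk.inj hm
  have hc := hcone i t ht (by linarith [hηle i])
  have hy0 := ((C i).mapsTo ht).2
  have hy1 : |(C i).f t| ≤ 1 := by rw [abs_of_nonpos hy0]; linarith
  have hc' : |t - a i| ≤ κ₀ * |(C i).f t| :=
    hc.trans (mul_le_mul_of_nonneg_right (hκle i) (abs_nonneg _))
  have hc1 : |t - a i| ≤ κ₀ := hc'.trans (mul_le_of_le_one_right hκ₀0 hy1)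
  refine ⟨a i + m, Finset.mem_image.2 ⟨(i, m), ?_, rfl⟩, ?_⟩
  · have hRm : |(m : ℝ)| ≤ R := by
      refine le_trans ?_ (Int.le_ceil _)
      have := hale i
      rw [abs_le] at *
      constructor <;> linarith
    rw [abs_le] at hRm
    simp only [Finset.mem_product, Finset.mem_univ, true_and, Finset.mem_Icc]
    exact ⟨by exact_mod_cast hRm.1, by exact_mod_cast hRm.2⟩
  · rwa [show t + (m : ℝ) - (a i + m) = t - a i by ring]

/-! ### Regularity of the data away from the jumps -/

namespace IsPiecewiseC2

variable {d n : ℕ} {δ : ℝ} {u₀ : ℝ × ℝ → Fin d → ℝ} {C : Fin n → JumpCurve δ}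

theorem exists_bound (hu : IsPiecewiseC2 δ u₀ C) {b : ℝ} (hb : b < δ) (B : ℝ) :
    ∃ M : ℝ, 0 ≤ M ∧ ∀ x y : ℝ, |x| ≤ B → -b ≤ y → y ≤ 0 → ‖u₀ (x, y)‖ ≤ M ∧
      ((x, y) ∉ jumpSet C →
        ‖fderivWithin ℝ u₀ (undamaged δ \ jumpSet C) (x, y)‖ ≤ M) := by
  set Q : Set (ℝ × ℝ) := Set.Icc (-B) B ×ˢ Set.Icc (-b) 0 with hQ
  have hcpt : IsCompact Q := isCompact_Icc.prod isCompact_Icc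
  have hsub : Q ⊆ undamaged δ := fun z hz => ⟨by linarith [hz.2.1], hz.2.2⟩
  obtain ⟨M, hM⟩ : ∃ M : ℝ, ∀ w ∈ Q, ‖u₀ w‖ ≤ M ∧ (w ∉ jumpSet C →
      ‖fderivWithin ℝ u₀ (undamaged δ \ jumpSet C) w‖ ≤ M) := by
    refine hcpt.induction_on (p := fun s => ∃ M : ℝ, ∀ w ∈ s, ‖u₀ w‖ ≤ M ∧ (w ∉ jumpSet C →
      ‖fderivWithin ℝ u₀ (undamaged δ \ jumpSet C) w‖ ≤ M)) ⟨0, by simp⟩ ?_ ?_ ?_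
    · rintro s t hst ⟨M, hM⟩
      exact ⟨M, fun w hw => hM w (hst hw)⟩
    · rintro s t ⟨M₁, hM₁⟩ ⟨M₂, hM₂⟩
      refine ⟨max M₁ M₂, fun w hw => ?_⟩
      rcases hw with hw | hw
      · exact ⟨(hM₁ w hw).1.trans (le_max_left _ _),
          fun hj => ((hM₁ w hw).2 hj).trans (le_max_left _ _)⟩
      · exact ⟨(hM₂ w hw).1.trans (le_max_right _ _),
          fun hj => ((hM₂ w hw).2 hj).trans (le_max_right _ _)⟩
    · intro z hz
      obtain ⟨M, hM⟩ := hu.locallyBounded z (hsub hz)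
      exact ⟨_, nhdsWithin_mono z hsub hM, M, fun w hw => hw⟩
  refine ⟨max M 0, le_max_right _ _, fun x y hx hy1 hy2 => ?_⟩
  have := hM (x, y) ⟨abs_le.1 hx, hy1, hy2⟩
  exact ⟨this.1.trans (le_max_left _ _), fun hj => (this.2 hj).trans (le_max_left _ _)⟩

theorem norm_sub_le (hu : IsPiecewiseC2 δ u₀ C) {T : Set (ℝ × ℝ)} (hT : Convex ℝ T)
    (hTs : T ⊆ undamaged δ \ jumpSet C) {M : ℝ}
    (hM : ∀ z ∈ T, ‖fderivWithin ℝ u₀ (undamaged δ \ jumpSet C) z‖ ≤ M) {z w : ℝ × ℝ}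
    (hz : z ∈ T) (hw : w ∈ T) : ‖u₀ z - u₀ w‖ ≤ M * ‖z - w‖ :=
  hT.norm_image_sub_le_of_norm_hasFDerivWithin_le
    (fun x hx => ((hu.contDiffOn.differentiableOn (by norm_num) x
      (hTs hx)).hasFDerivWithinAt).mono hTs) hM hw hz

/-- A Lipschitz estimate along a vertical and a horizontal segment that avoid the jump set. -/
theorem norm_sub_le_path (hu : IsPiecewiseC2 δ u₀ C) {b B M : ℝ} (hb : b < δ)
    (hM : ∀ x y : ℝ, |x| ≤ B → -b ≤ y → y ≤ 0 → (x, y) ∉ jumpSet C →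
      ‖fderivWithin ℝ u₀ (undamaged δ \ jumpSet C) (x, y)‖ ≤ M) {x x' y : ℝ} (hx : |x| ≤ B)
    (hx' : |x'| ≤ B) (hy : -b ≤ y) (hy0 : y ≤ 0)
    (hv : ∀ t, y ≤ t → t ≤ 0 → (x, t) ∉ jumpSet C)
    (hh : ∀ t ∈ Set.uIcc x x', (t, (0 : ℝ)) ∉ jumpSet C) :
    ‖u₀ (x, y) - u₀ (x', 0)‖ ≤ M * |y| + M * |x - x'| := by
  have hxu : ∀ t ∈ Set.uIcc x x', |t| ≤ B := by
    intro t ht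
    rw [abs_le] at *
    rw [Set.mem_uIcc] at ht
    rcases ht with ht | ht <;> constructor <;> linarith [ht.1, ht.2]
  have h1 : ‖u₀ (x, y) - u₀ (x, 0)‖ ≤ M * ‖((x, y) : ℝ × ℝ) - (x, 0)‖ := by
    refine hu.norm_sub_le (T := {x} ×ˢ Set.Icc y 0) ((convex_singleton x).prod (convex_Icc y 0))
      ?_ ?_ ⟨rfl, le_rfl, hy0⟩ ⟨rfl, hy0, le_rfl⟩
    · rintro ⟨s, t⟩ ⟨hs, ht⟩
      obtain rfl : s = x := hs
      exact ⟨⟨by linarith [ht.1], ht.2⟩, hv t ht.1 ht.2⟩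
    · rintro ⟨s, t⟩ ⟨hs, ht⟩
      obtain rfl : s = x := hs
      exact hM s t hx (hy.trans ht.1) ht.2 (hv t ht.1 ht.2)
  have h2 : ‖u₀ (x, 0) - u₀ (x', 0)‖ ≤ M * ‖((x, 0) : ℝ × ℝ) - (x', 0)‖ := by
    refine hu.norm_sub_le (T := Set.uIcc x x' ×ˢ {0}) ((convex_uIcc x x').prod (convex_singleton 0))
      ?_ ?_ ⟨Set.left_mem_uIcc, rfl⟩ ⟨Set.right_mem_uIcc, rfl⟩
    · rintro ⟨s, t⟩ ⟨hs, ht⟩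
      obtain rfl : t = 0 := ht
      exact ⟨⟨show -δ < 0 by linarith, le_rfl⟩, hh s hs⟩
    · rintro ⟨s, t⟩ ⟨hs, ht⟩
      obtain rfl : t = 0 := ht
      exact hM s 0 (hxu s hs) (by linarith) le_rfl (hh s hs)
  have e1 : ‖((x, y) : ℝ × ℝ) - (x, 0)‖ = |y| := by simp [Prod.norm_def]
  have e2 : ‖((x, 0) : ℝ × ℝ) - (x', 0)‖ = |x - x'| := by simp [Prod.norm_def]
  rw [e1] at h1
  rw [e2] at h2
  calc ‖u₀ (x, y) - u₀ (x', 0)‖ = ‖(u₀ (x, y) - u₀ (x, 0)) + (u₀ (x, 0) - u₀ (x', 0))‖ := by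
        rw [sub_add_sub_cancel]
    _ ≤ _ := (norm_add_le _ _).trans (add_le_add h1 h2)

end IsPiecewiseC2

/-- The slope `β` is the derivative at `x'`; one constant bounds the first and second derivatives on
the interval. -/
theorem exists_taylor_bound {φ : ℝ → ℝ} (hφ : ContDiff ℝ 2 φ) (B : ℝ) :
    ∃ K : ℝ, 0 ≤ K ∧ ∀ x', |x'| ≤ B → ∃ β, |β| ≤ K ∧ ∀ x, |x| ≤ B →
      |φ x - φ x' - β * (x - x')| ≤ K * (x - x') ^ 2 := by
  have hd : Differentiable ℝ φ := hφ.differentiable (by norm_num)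
  have h1 : ContDiff ℝ 1 (deriv φ) :=
    (contDiff_succ_iff_deriv (n := 1).1 (by rw [one_add_one_eq_two]; exact hφ)).2.2
  have h2 : Continuous (deriv (deriv φ)) := h1.continuous_deriv le_rfl
  obtain ⟨K₁, hK₁⟩ := (isCompact_Icc (a := -B) (b := B)).exists_bound_of_continuousOn
    h1.continuous.continuousOn
  obtain ⟨K₂, hK₂⟩ := (isCompact_Icc (a := -B) (b := B)).exists_bound_of_continuousOn
    h2.continuousOn
  refine ⟨max (max K₁ K₂) 0, le_max_right _ _, fun x' hx' => ⟨deriv φ x', ?_, fun x hx => ?_⟩⟩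
  · exact (hK₁ x' (abs_le.1 hx')).trans ((le_max_left _ _).trans (le_max_left _ _))
  set K := max (max K₁ K₂) 0
  have hsub : Set.uIcc x' x ⊆ Set.Icc (-B) B :=
    Set.uIcc_subset_Icc (abs_le.1 hx') (abs_le.1 hx)
  have h3 : ∀ t ∈ Set.uIcc x' x, |deriv φ t - deriv φ x'| ≤ K * |x - x'| := by
    intro t ht
    have := (convex_Icc (-B) B).norm_image_sub_le_of_norm_deriv_le (f := deriv φ) (C := K)
      (fun s _ => h1.differentiable (by norm_num) s)
      (fun s hs => (hK₂ s hs).trans ((le_max_right _ _).trans (le_max_left _ _)))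
      (hsub Set.left_mem_uIcc) (hsub ht)
    refine this.trans (mul_le_mul_of_nonneg_left ?_ (le_max_right _ _))
    rw [Real.norm_eq_abs]
    exact Set.abs_sub_left_of_mem_uIcc ht
  have h4 := (convex_uIcc x' x).norm_image_sub_le_of_norm_hasDerivWithin_le
    (f := fun t => φ t - deriv φ x' * t) (f' := fun t => deriv φ t - deriv φ x')
    (fun t _ => ((hd t).hasDerivAt.sub
      (by simpa using (hasDerivAt_id t).const_mul (deriv φ x'))).hasDerivWithinAt)
    h3 Set.left_mem_uIcc Set.right_mem_uIcc
  simp only [Real.norm_eq_abs] at h4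
  rw [mul_assoc, ← sq, sq_abs] at h4
  rwa [show φ x - φ x' - deriv φ x' * (x - x')
    = φ x - deriv φ x' * x - (φ x' - deriv φ x' * x') by ring]

theorem IsPiecewiseC2.contDiff_trace {d : ℕ} {δ : ℝ} (hδ : 0 < δ) {u₀ : ℝ × ℝ → Fin d → ℝ}
    {C : Fin 0 → JumpCurve δ} (hu : IsPiecewiseC2 δ u₀ C) (c : Fin d) :
    ContDiff ℝ 2 fun x : ℝ => u₀ (x, 0) c := by
  have h1 : ContDiff ℝ 2 fun x : ℝ => u₀ (x, 0) := by
    rw [← contDiffOn_univ]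
    refine hu.contDiffOn.comp (f := fun x : ℝ => (x, (0 : ℝ)))
      (contDiff_id.prodMk contDiff_const).contDiffOn fun x _ => ?_
    refine ⟨⟨show -δ < 0 by linarith, le_rfl⟩, ?_⟩
    rintro ⟨i, -⟩
    exact i.elim0
  exact contDiff_pi.1 h1 c

/-! ### Discrete norms -/

theorem sum_Icc_sub (F : ℤ → ℝ) (N : ℕ) :
    ∑ i ∈ Finset.Icc 1 (N : ℤ), (F (i + 1) - F i) = F (N + 1) - F 1 := by
  have h := Finset.sum_range_sub (fun k : ℕ => F (k + 1)) N
  simp only [Nat.cast_zero, zero_add] at h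
  rw [← h]
  symm
  refine Finset.sum_bij (fun k _ => (k : ℤ) + 1) (fun k hk => ?_) (fun a _ b _ hab => ?_)
    (fun i hi => ?_) fun k _ => ?_
  · rw [Finset.mem_range] at hk
    rw [Finset.mem_Icc]; omega
  · simpa using hab
  · rw [Finset.mem_Icc] at hi
    exact ⟨(i - 1).toNat, by rw [Finset.mem_range]; omega, by omega⟩
  · push_cast; rfl

/-- The function `t / (s + |t|)` has derivative `s / (s + |t|)²`, so its increment over a unit step
dominates the summand up to the factor `8`. Its values stay in `[-1, 1]`, so the telescoped sum is
bounded uniformly in `N`. -/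
theorem inv_sq_add_le {s : ℝ} (hs : 1 ≤ s) (t : ℝ) :
    s / (t ^ 2 + s ^ 2) ≤ 8 * ((t + 1) / (s + |t + 1|) - t / (s + |t|)) := by
  have h1 : s / (t ^ 2 + s ^ 2) ≤ 8 * (s / (s + |t| + 1) ^ 2) := by
    have h0 := abs_nonneg t
    rw [← mul_div_assoc, div_le_div_iff₀ (by positivity) (by positivity)]
    have : (s + |t| + 1) ^ 2 ≤ 8 * (t ^ 2 + s ^ 2) := by
      rw [← sq_abs t]; nlinarith [sq_nonneg (s - |t|)]
    nlinarith
  refine h1.trans (mul_le_mul_of_nonneg_left ?_ (by norm_num))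
  rcases le_or_gt 0 t with h | h
  · rw [abs_of_nonneg h, abs_of_nonneg (by linarith), div_sub_div _ _ (by positivity)
      (by positivity), div_le_div_iff₀ (by positivity) (by positivity)]
    nlinarith [mul_nonneg h (by linarith : (0 : ℝ) ≤ s), sq_nonneg (s + t + 1)]
  · rcases le_or_gt t (-1) with h' | h'
    · rw [abs_of_neg h, abs_of_nonpos (by linarith)]
      obtain ⟨w, rfl⟩ : ∃ w, t = -w := ⟨-t, by ring⟩
      have hw : 1 ≤ w := by linarith
      have p1 : 0 < s + -(-w + 1) := by linarith
      have p2 : 0 < s + - -w := by linarith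
      have p3 : 0 < s + - -w + 1 := by linarith
      have e : (-w + 1) / (s + -(-w + 1)) - -w / (s + - -w)
          = s / ((s + -(-w + 1)) * (s + - -w)) := by
        field_simp; ring
      rw [e]
      refine div_le_div_of_nonneg_left (by linarith) (mul_pos p1 p2) ?_
      nlinarith
    · rw [abs_of_neg h, abs_of_pos (by linarith)]
      have p1 : 0 < s + (t + 1) := by linarith
      have p2 : 0 < s + -t := by linarith
      have p3 : 0 < s + -t + 1 := by linarith
      have a1 : (t + 1) / (s + 1) ≤ (t + 1) / (s + (t + 1)) :=
        div_le_div_of_nonneg_left (by linarith) p1 (by linarith)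
      have a2 : -t / (s + 1) ≤ -t / (s + -t) :=
        div_le_div_of_nonneg_left (by linarith) p2 (by linarith)
      have a3 : s / (s + -t + 1) ^ 2 ≤ 1 / (s + 1) := by
        rw [div_le_div_iff₀ (by positivity) (by linarith)]
        nlinarith
      have a4 : (t + 1) / (s + 1) + -t / (s + 1) = 1 / (s + 1) := by
        rw [← add_div]; ring
      have a5 : -t / (s + -t) = -(t / (s + -t)) := neg_div _ _
      linarith

theorem sum_inv_sq_add_le {s : ℝ} (hs : 1 ≤ s) (α : ℝ) (N : ℕ) :
    ∑ i ∈ Finset.Icc 1 (N : ℤ), s / (((i : ℝ) - α) ^ 2 + s ^ 2) ≤ 16 := by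
  set G : ℝ → ℝ := fun t => t / (s + |t|) with hG
  have hG1 : ∀ t, |G t| ≤ 1 := by
    intro t
    have : 0 < s + |t| := by positivity
    rw [hG, abs_div, abs_of_pos this, div_le_one this]
    linarith
  calc ∑ i ∈ Finset.Icc 1 (N : ℤ), s / (((i : ℝ) - α) ^ 2 + s ^ 2)
      ≤ ∑ i ∈ Finset.Icc 1 (N : ℤ), 8 * (G (((i + 1 : ℤ) : ℝ) - α) - G ((i : ℝ) - α)) := by
        refine Finset.sum_le_sum fun i _ => ?_
        have := inv_sq_add_le hs ((i : ℝ) - α)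
        rwa [show (i : ℝ) - α + 1 = ((i + 1 : ℤ) : ℝ) - α by push_cast; ring] at this
    _ = 8 * (G (((N + 1 : ℤ) : ℝ) - α) - G (((1 : ℤ) : ℝ) - α)) := by
        rw [← Finset.mul_sum, sum_Icc_sub fun i : ℤ => G ((i : ℝ) - α)]
    _ ≤ 16 := by
        have h1 := (abs_le.1 (hG1 (((N + 1 : ℤ) : ℝ) - α))).2
        have h2 := (abs_le.1 (hG1 (((1 : ℤ) : ℝ) - α))).1
        linarith

/-- Dividing by `h²` turns each term into `N / ((i - t / h)² + N)`, the previous sum with `s = √N`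
multiplied by `√N = N √h`. -/
theorem sum_row_le {N : ℕ} {h : ℝ} (hh : h * N = 1) (h0 : 0 < h) (t : ℝ) :
    ∑ i ∈ Finset.Icc 1 (N : ℤ), h / (((i : ℝ) * h - t) ^ 2 + h) ≤ 16 * (N * √h) := by
  have hN0 : (0 : ℝ) < N := by
    by_contra hcon
    have : (N : ℝ) = 0 := le_antisymm (not_lt.1 hcon) (Nat.cast_nonneg N)
    rw [this] at hh; simp at hh
  have hN1 : (1 : ℝ) ≤ N := by
    have : 0 < N := by exact_mod_cast hN0
    exact_mod_cast this
  have hs : 1 ≤ √(N : ℝ) := by rw [Real.one_le_sqrt]; exact hN1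
  have hsq : √(N : ℝ) ^ 2 = N := Real.sq_sqrt hN0.le
  have hNh : (N : ℝ) * √h = √N := by
    have : h = (N : ℝ)⁻¹ := eq_inv_of_mul_eq_one_left hh
    rw [this, Real.sqrt_inv, ← hsq, Real.sqrt_sq (by positivity)]
    field_simp
  have e : ∀ i : ℤ, h / (((i : ℝ) * h - t) ^ 2 + h)
      = √N * (√N / (((i : ℝ) - t / h) ^ 2 + √(N : ℝ) ^ 2)) := by
    intro i
    have e1 : ((i : ℝ) * h - t) ^ 2 + h = h * h * (((i : ℝ) - t / h) ^ 2 + N) := by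
      have : h * h * N = h := by rw [mul_assoc, hh, mul_one]
      rw [mul_add, this]
      field_simp
    rw [e1, hsq, ← mul_div_assoc, Real.mul_self_sqrt hN0.le]
    have : 0 < ((i : ℝ) - t / h) ^ 2 + N := by positivity
    rw [div_eq_div_iff (by positivity) this.ne']
    linear_combination (-(h * (((i : ℝ) - t / h) ^ 2 + N))) * hh
  simp only [e, ← Finset.mul_sum]
  rw [hNh, mul_comm 16]
  exact mul_le_mul_of_nonneg_left (sum_inv_sq_add_le hs _ N) (by positivity)

/-! ### From pointwise bounds to discrete norms -/

theorem card_pixelGrid (N : ℕ) : (pixelGrid N).card = N * N := by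
  simp [pixelGrid]

theorem nonempty_pixelGrid {N : ℕ} (hN : 0 < N) : (pixelGrid N).Nonempty :=
  ⟨(1, 1), by simp only [pixelGrid, Finset.mem_product, Finset.mem_Icc]; omega⟩

theorem discreteNorm_top_le {N : ℕ} (hN : 0 < N) {f : ℤ × ℤ → ℝ} {E : ℝ}
    (hf : ∀ q ∈ pixelGrid N, |f q| ≤ E) : discreteNorm ⊤ N f ≤ E := by
  have := (nonempty_pixelGrid hN).to_subtype
  rw [discreteNorm, if_pos rfl]
  exact ciSup_le fun q => hf q q.2

theorem discreteNorm_le_of_forall_le {p : ℝ≥0∞} (hp : 1 ≤ p) {N : ℕ} (hN : 0 < N)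
    {f : ℤ × ℤ → ℝ} {E : ℝ} (hE : 0 ≤ E) (hf : ∀ q ∈ pixelGrid N, |f q| ≤ E) :
    discreteNorm p N f ≤ E := by
  by_cases htop : p = ⊤
  · subst htop; exact discreteNorm_top_le hN hf
  have hP : 1 ≤ p.toReal := by
    rw [← ENNReal.toReal_one]; exact ENNReal.toReal_mono htop hp
  have hN' : (N : ℝ) ≠ 0 := by exact_mod_cast hN.ne'
  have hle : ∑ q ∈ pixelGrid N, |f q| ^ p.toReal * (1 / (N : ℝ)) ^ 2 ≤ E ^ p.toReal := by
    calc ∑ q ∈ pixelGrid N, |f q| ^ p.toReal * (1 / (N : ℝ)) ^ 2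
        ≤ ∑ q ∈ pixelGrid N, E ^ p.toReal * (1 / (N : ℝ)) ^ 2 :=
          Finset.sum_le_sum fun q hq => mul_le_mul_of_nonneg_right
            (Real.rpow_le_rpow (abs_nonneg _) (hf q hq) (by linarith)) (by positivity)
      _ = E ^ p.toReal := by
          rw [Finset.sum_const, card_pixelGrid, nsmul_eq_mul]
          push_cast
          field_simp
  rw [discreteNorm, if_neg htop]
  calc (∑ q ∈ pixelGrid N, |f q| ^ p.toReal * (1 / (N : ℝ)) ^ 2) ^ (1 / p.toReal)
      ≤ (E ^ p.toReal) ^ (1 / p.toReal) :=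
        Real.rpow_le_rpow (Finset.sum_nonneg fun q _ => by positivity) hle (by positivity)
    _ = E := by
        rw [← Real.rpow_mul hE, mul_one_div_cancel (by linarith), Real.rpow_one]

/-- Interpolation between `L¹` and `L^∞`: `|f|^p ≤ K^(p-1) |f|`. At `p = ⊤` the exponent is zero and
only the uniform bound is used. -/
theorem discreteNorm_le_of_sum_le {p : ℝ≥0∞} (hp : 1 ≤ p) {N : ℕ} (hN : 0 < N) {h : ℝ}
    (h0 : 0 < h) {f : ℤ × ℤ → ℝ} {K : ℝ} (hK : 0 ≤ K) (hf : ∀ q ∈ pixelGrid N, |f q| ≤ K)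
    (hsum : ∑ q ∈ pixelGrid N, |f q| * (1 / (N : ℝ)) ^ 2 ≤ K * √h) :
    discreteNorm p N f ≤ K * h ^ (1 / (2 * p)).toReal := by
  by_cases htop : p = ⊤
  · subst htop
    simpa using discreteNorm_top_le hN hf
  have hP : 1 ≤ p.toReal := by
    rw [← ENNReal.toReal_one]; exact ENNReal.toReal_mono htop hp
  set P := p.toReal with hPdef
  have hsplit : ∀ x : ℝ, 0 ≤ x → x ^ P = x ^ (P - 1) * x := by
    intro x hx
    rw [← Real.rpow_add_one' hx (by linarith), sub_add_cancel]
  have hle : ∑ q ∈ pixelGrid N, |f q| ^ P * (1 / (N : ℝ)) ^ 2 ≤ K ^ P * √h := by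
    calc ∑ q ∈ pixelGrid N, |f q| ^ P * (1 / (N : ℝ)) ^ 2
        ≤ ∑ q ∈ pixelGrid N, K ^ (P - 1) * (|f q| * (1 / (N : ℝ)) ^ 2) := by
          refine Finset.sum_le_sum fun q hq => ?_
          rw [hsplit _ (abs_nonneg _), mul_assoc]
          exact mul_le_mul_of_nonneg_right
            (Real.rpow_le_rpow (abs_nonneg _) (hf q hq) (by linarith)) (by positivity)
      _ ≤ K ^ (P - 1) * (K * √h) := by
          rw [← Finset.mul_sum]
          exact mul_le_mul_of_nonneg_left hsum (by positivity)
      _ = K ^ P * √h := by rw [hsplit K hK, mul_assoc]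
  have hexp : (1 / (2 * p)).toReal = 1 / 2 * (1 / P) := by
    rw [ENNReal.toReal_div, ENNReal.toReal_mul]
    simp [hPdef, mul_comm]
  rw [discreteNorm, if_neg htop, hexp, ← hPdef]
  calc (∑ q ∈ pixelGrid N, |f q| ^ P * (1 / (N : ℝ)) ^ 2) ^ (1 / P)
      ≤ (K ^ P * √h) ^ (1 / P) :=
        Real.rpow_le_rpow (Finset.sum_nonneg fun q _ => by positivity) hle (by positivity)
    _ = K * h ^ (1 / 2 * (1 / P)) := by
        rw [Real.mul_rpow (by positivity) (by positivity), ← Real.rpow_mul hK,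
          mul_one_div_cancel (by linarith), Real.rpow_one, Real.sqrt_eq_rpow, ← Real.rpow_mul h0.le]

/-! ### Pointwise error estimates -/

/-- `U` extends the boundary values `b` from the rows `j ≤ 0` to the rows `1, …, N` by averaging
over the stencil `ρ`. -/
structure IsStencilExtension (r : ℕ) (ρ : ℤ × ℤ → ℝ) (N : ℕ) (b U : ℤ × ℤ → ℝ) : Prop where
  boundary : ∀ p : ℤ × ℤ, p.2 ≤ 0 → U p = b p
  average : ∀ p : ℤ × ℤ, 1 ≤ p.2 → p.2 ≤ N → U p = ∑ q ∈ stencilBox r, ρ q * U (p + q)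

/-- The boundary pixels on which the value at a pixel of the grid depends lie in a fixed box. -/
theorem boundary_pixel_bounds {N r : ℕ} {δ h : ℝ} (hr : 2 ≤ r) (hh : h * N = 1) (h0 : 0 < h)
    (hδ : r * h < δ) {p₀ p : ℤ × ℤ} (hp₀ : p₀ ∈ pixelGrid N) (h1 : -(r : ℤ) < p.2) (h2 : p.2 ≤ 0)
    (hcone : |p.1 - p₀.1| ≤ r * (p₀.2 - p.2)) :
    |(p.1 : ℝ) * h| ≤ 1 + r + r ^ 2 ∧ -(δ * (r - 1) / r) ≤ p.2 * h ∧ (p.2 : ℝ) * h ≤ 0 ∧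
      |(p.2 : ℝ) * h| ≤ r * h := by
  simp only [pixelGrid, Finset.mem_product, Finset.mem_Icc] at hp₀
  obtain ⟨⟨a1, a2⟩, a3, a4⟩ := hp₀
  have hr' : (2 : ℝ) ≤ r := by exact_mod_cast hr
  have b1 : -(r : ℝ) + 1 ≤ p.2 := by exact_mod_cast h1
  have b2 : (p.2 : ℝ) ≤ 0 := by exact_mod_cast h2
  have hNZ : (1 : ℤ) ≤ N := by omega
  have hN : (1 : ℝ) ≤ N := by exact_mod_cast hNZ
  have hh1 : h ≤ 1 := by nlinarith
  refine ⟨?_, ?_, by nlinarith, ?_⟩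
  · have c1 : |p.1| ≤ N + r * (N + r) := by
      have d1 : |p₀.1| ≤ N := abs_le.2 ⟨by omega, a2⟩
      have d2 : |p.1| ≤ |p.1 - p₀.1| + |p₀.1| := by
        have := abs_add_le (p.1 - p₀.1) p₀.1
        rwa [sub_add_cancel] at this
      have d3 : (r : ℤ) * (p₀.2 - p.2) ≤ r * (N + r) :=
        mul_le_mul_of_nonneg_left (by omega) (by omega)
      linarith
    have c2 : |(p.1 : ℝ)| ≤ N + r * (N + r) := by exact_mod_cast c1
    rw [abs_mul, abs_of_pos h0]
    calc |(p.1 : ℝ)| * h ≤ (N + r * (N + r)) * h := by gcongr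
      _ = 1 + r + r ^ 2 * h := by linear_combination (1 + (r : ℝ)) * hh
      _ ≤ 1 + r + r ^ 2 := by nlinarith [sq_nonneg (r : ℝ)]
  · rw [neg_le, div_eq_mul_inv, ← neg_mul, mul_right_comm]
    have e1 : h ≤ δ * (r : ℝ)⁻¹ := by
      rw [← div_eq_mul_inv, le_div_iff₀ (by linarith), mul_comm]; exact hδ.le
    have e2 : -(p.2 : ℝ) ≤ r - 1 := by linarith
    calc -(p.2 : ℝ) * h ≤ (r - 1) * h := by gcongr
      _ ≤ (r - 1) * (δ * (r : ℝ)⁻¹) := by gcongr; linarith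
      _ = _ := by ring
  · rw [abs_mul, abs_of_pos h0, abs_of_nonpos b2]
    gcongr
    linarith

theorem foot_bound {N r : ℕ} {h m : ℝ} (hh : h * N = 1) (h0 : 0 < h) (hm : |m| ≤ r) {p₀ : ℤ × ℤ}
    (hp₀ : p₀ ∈ pixelGrid N) : |(p₀.1 : ℝ) * h - m * (p₀.2 * h)| ≤ 1 + r + r ^ 2 := by
  simp only [pixelGrid, Finset.mem_product, Finset.mem_Icc] at hp₀
  obtain ⟨⟨a1, a2⟩, a3, a4⟩ := hp₀
  have b : ∀ i : ℤ, 1 ≤ i → i ≤ N → |(i : ℝ) * h| ≤ 1 := by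
    intro i i1 i2
    have c1 : (1 : ℝ) ≤ i := by exact_mod_cast i1
    have c2 : (i : ℝ) ≤ N := by exact_mod_cast i2
    rw [abs_of_nonneg (by positivity)]
    nlinarith
  have e1 := abs_sub ((p₀.1 : ℝ) * h) (m * (p₀.2 * h))
  have e2 : |m * ((p₀.2 : ℝ) * h)| ≤ r := by
    rw [abs_mul]
    calc |m| * |(p₀.2 : ℝ) * h| ≤ r * 1 :=
          mul_le_mul hm (b _ a3 a4) (abs_nonneg _) (Nat.cast_nonneg r)
      _ = r := mul_one _
  nlinarith [b _ a1 a2, sq_nonneg (r : ℝ)]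

variable {d n : ℕ} {δ : ℝ} {u₀ : ℝ × ℝ → Fin d → ℝ}

/-- The boundary rows read satisfy `j > -r`, so their depth is at most `(r - 1) h < δ (r - 1) / r`.
This depth is independent of `h` and strictly less than `δ`, which gives compactness although the
region is open at `-δ`. -/
theorem depth_lt {r : ℕ} (hr : 2 ≤ r) (hδ : 0 < δ) :
    0 ≤ δ * (r - 1) / r ∧ δ * (r - 1) / r < δ := by
  have hr' : (2 : ℝ) ≤ r := by exact_mod_cast hr
  constructor
  · exact div_nonneg (mul_nonneg hδ.le (by linarith)) (by linarith)
  · rw [div_lt_iff₀ (by linarith)]; nlinarith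

/-- Without jumps the error is of first order, uniformly in the stencil. -/
theorem IsPiecewiseC2.exists_error_le_of_no_jumps (hδ : 0 < δ) {r : ℕ} (hr : 2 ≤ r)
    {C : Fin 0 → JumpCurve δ} (hu : IsPiecewiseC2 δ u₀ C) :
    ∃ K : ℝ, 0 ≤ K ∧ ∀ (ρ : ℤ × ℤ → ℝ) (v : ℝ × ℝ), IsStencil r ρ v → ∀ (N : ℕ) (h : ℝ),
      h * N = 1 → 0 < h → r * h < δ → ∀ (c : Fin d) (U : ℤ × ℤ → ℝ),
      IsStencilExtension r ρ N (fun q => u₀ (pos h q) c) U → ∀ p₀ ∈ pixelGrid N,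
      |u₀ (p₀.1 * h - v.1 / v.2 * (p₀.2 * h), 0) c - U p₀| ≤ K * h := by
  obtain ⟨hb0, hb⟩ := depth_lt hr hδ
  set b := δ * (r - 1) / r
  set B : ℝ := 1 + r + r ^ 2
  obtain ⟨M, hM0, hM⟩ := hu.exists_bound hb B
  choose K₀ hK₀ hT using fun c => exists_taylor_bound (hu.contDiff_trace hδ c) B
  set K := ∑ c, K₀ c
  have hKle : ∀ c, K₀ c ≤ K := fun c =>
    Finset.single_le_sum (f := K₀) (fun j _ => hK₀ j) (Finset.mem_univ c)
  have hK0 : 0 ≤ K := Finset.sum_nonneg fun j _ => hK₀ j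
  set W : ℝ := (r + r ^ 2) ^ 2 * (1 + r) with hW
  refine ⟨M * r + K * r ^ 2 + 2 * K * r ^ 4 + 2 * K * W, by positivity, ?_⟩
  intro ρ v hρ N h hh h0 hrh c U hU p₀ hp₀
  set m := v.1 / v.2 with hm
  have hmr : |m| ≤ r := hρ.abs_slope_le
  set x' := p₀.1 * h - m * (p₀.2 * h) with hx'
  have hx'B : |x'| ≤ B := foot_bound hh h0 hmr hp₀
  obtain ⟨β, hβ, hTay⟩ := hT c x' hx'B
  have hgrid := hp₀
  simp only [pixelGrid, Finset.mem_product, Finset.mem_Icc] at hgrid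
  have hh1 : h ≤ 1 := by
    have : (1 : ℤ) ≤ N := by omega
    have : (1 : ℝ) ≤ N := by exact_mod_cast this
    nlinarith
  -- Three `O(h)` errors form `A`: moving vertically to `y = 0`, replacing `x - x'` by `ζ` in the
  -- linear term, and the same replacement in the quadratic term.
  have key := hρ.abs_sub_le_of_boundary hU.average hh hgrid.2.1 hgrid.2.2
    (ζ := fun p => p.1 * h - x' - m * (p.2 * h)) (fun p => rfl)
    (A := (M * r + K * r ^ 2 + 2 * K * r ^ 4) * h) (B := 2 * K) (β := β) (c := u₀ (x', 0) c)
    (by positivity) ?_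
  · rw [abs_sub_comm]
    refine key.trans (le_of_eq ?_)
    ring
  intro p h1 h2 hcone
  obtain ⟨hpB, hpb, hp0, hpr⟩ := boundary_pixel_bounds hr hh h0 hrh hp₀ h1 h2 hcone
  rw [hU.boundary p h2]
  simp only [pos]
  set x := (p.1 : ℝ) * h
  set y := (p.2 : ℝ) * h
  have hJ : ∀ z, z ∉ jumpSet C := by rintro z ⟨i, -⟩; exact i.elim0
  have e1 : |u₀ (x, y) c - u₀ (x, 0) c| ≤ M * |y| := by
    have := hu.norm_sub_le_path hb (fun x y hx hy hy0 hj => (hM x y hx hy hy0).2 hj) hpB hpB hpb hp0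
      (fun _ _ _ => hJ _) (fun _ _ => hJ _)
    rw [sub_self, abs_zero, mul_zero, add_zero] at this
    exact (norm_le_pi_norm (u₀ (x, y) - u₀ (x, 0)) c).trans this
  have e2 : |u₀ (x, 0) c - u₀ (x', 0) c - β * (x - x')| ≤ K * (x - x') ^ 2 :=
    (hTay x hpB).trans (mul_le_mul_of_nonneg_right (hKle c) (sq_nonneg _))
  have hmy : |m * y| ≤ r ^ 2 * h := by
    rw [abs_mul, sq, mul_assoc]
    exact mul_le_mul hmr hpr (abs_nonneg _) (Nat.cast_nonneg r)
  have e3 : |β * (m * y)| ≤ K * (r ^ 2 * h) := by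
    rw [abs_mul]
    exact mul_le_mul (hβ.trans (hKle c)) hmy (abs_nonneg _) hK0
  have e4 : (x - x') ^ 2 ≤ 2 * (x - x' - m * y) ^ 2 + 2 * (r ^ 4 * h) := by
    have f1 : (m * y) ^ 2 ≤ r ^ 4 * h := by
      rw [← sq_abs]
      calc |m * y| ^ 2 ≤ (r ^ 2 * h) ^ 2 := by gcongr
        _ = r ^ 4 * (h * h) := by ring
        _ ≤ r ^ 4 * (h * 1) := by gcongr
        _ = r ^ 4 * h := by ring
    nlinarith [sq_nonneg (x - x' - 2 * (m * y))]
  have e5 := mul_le_mul_of_nonneg_left e4 hK0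
  have e6 : M * |y| ≤ M * (r * h) := mul_le_mul_of_nonneg_left hpr hM0
  have e7 : u₀ (x, y) c - u₀ (x', 0) c - β * (x - x' - m * y)
      = (u₀ (x, y) c - u₀ (x, 0) c) + (u₀ (x, 0) c - u₀ (x', 0) c - β * (x - x'))
        + β * (m * y) := by ring
  rw [e7]
  refine (abs_add_le _ _).trans ((add_le_add_left (abs_add_le _ _) _).trans ?_)
  linarith

/-- The boundary values are Lipschitz from the line `y = 0` into the undamaged region, unless one of
finitely many jumps is close. -/
theorem IsPiecewiseC2.exists_lipschitz_or_jump {C : Fin n → JumpCurve δ}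
    (hu : IsPiecewiseC2 δ u₀ C) {b : ℝ} (hb : b < δ) (B : ℝ) :
    ∃ (T : Finset ℝ) (η κ M : ℝ), 0 < η ∧ 0 ≤ κ ∧ 0 ≤ M ∧
      (∀ x y, |x| ≤ B → -b ≤ y → y ≤ 0 → ‖u₀ (x, y)‖ ≤ M) ∧
      ∀ x x' y, |x| ≤ B → |x'| ≤ B → -b ≤ y → y ≤ 0 → -η ≤ y →
        ‖u₀ (x, y) - u₀ (x', 0)‖ ≤ M * |y| + M * |x - x'| ∨
        ∃ a ∈ T, |x' - a| ≤ |x - x'| + κ * |y| := by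
  obtain ⟨M, hM0, hM⟩ := hu.exists_bound hb B
  obtain ⟨T, η, κ, hη, hκ, hcones⟩ := exists_jump_cones C B
  refine ⟨T, η, κ, M, hη, hκ, hM0, fun x y hx hy hy0 => (hM x y hx hy hy0).1, ?_⟩
  intro x x' y hx hx' hy hy0 hyη
  by_cases hgood : (∀ t, y ≤ t → t ≤ 0 → (x, t) ∉ jumpSet C) ∧
      ∀ t ∈ Set.uIcc x x', (t, (0 : ℝ)) ∉ jumpSet C
  · exact Or.inl (hu.norm_sub_le_path hb (fun x y hx hy hy0 hj => (hM x y hx hy hy0).2 hj) hx hx' hy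
      hy0 hgood.1 hgood.2)
  right
  by_contra! hcon
  refine hgood ⟨fun t ht ht0 hj => ?_, fun t ht hj => ?_⟩
  · obtain ⟨a, ha, hxa⟩ := hcones x t hx (by linarith) hj
    have g1 : |t| ≤ |y| := by rw [abs_of_nonpos ht0, abs_of_nonpos hy0]; linarith
    have g2 := mul_le_mul_of_nonneg_left g1 hκ
    have g3 := abs_sub_le x' x a
    rw [abs_sub_comm x' x] at g3
    linarith [hcon a ha]
  · have htB : |t| ≤ B := abs_le.2 (Set.uIcc_subset_Icc (abs_le.1 hx) (abs_le.1 hx') ht)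
    obtain ⟨a, ha, hxa⟩ := hcones t 0 htB (by linarith) hj
    rw [abs_zero, mul_zero] at hxa
    have g1 := Set.abs_sub_right_of_mem_uIcc ht
    have g2 := abs_sub_le x' t a
    have g3 := hcon a ha
    rw [abs_sub_comm x' x] at g1
    have : 0 ≤ κ * |y| := by positivity
    linarith

/-- With jumps the error is controlled by the distance of the foot of the characteristic from the
finitely many jumps of the boundary values, uniformly in the stencil. -/
theorem IsPiecewiseC2.exists_error_le (hδ : 0 < δ) {r : ℕ} (hr : 2 ≤ r)
    {C : Fin n → JumpCurve δ} (hu : IsPiecewiseC2 δ u₀ C) :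
    ∃ (T : Finset ℝ) (K : ℝ), 0 ≤ K ∧ ∀ (ρ : ℤ × ℤ → ℝ) (v : ℝ × ℝ), IsStencil r ρ v →
      ∀ (N : ℕ) (h : ℝ), h * N = 1 → 0 < h → r * h < δ → ∀ (c : Fin d) (U : ℤ × ℤ → ℝ),
      IsStencilExtension r ρ N (fun q => u₀ (pos h q) c) U → ∀ p₀ ∈ pixelGrid N,
      |u₀ (p₀.1 * h - v.1 / v.2 * (p₀.2 * h), 0) c - U p₀| ≤ K ∧
      |u₀ (p₀.1 * h - v.1 / v.2 * (p₀.2 * h), 0) c - U p₀| ≤ K * (√h +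
        ∑ a ∈ T, h / ((p₀.1 * h - v.1 / v.2 * (p₀.2 * h) - a) ^ 2 + h)) := by
  obtain ⟨hb0, hb⟩ := depth_lt hr hδ
  set b := δ * (r - 1) / r
  set B : ℝ := 1 + r + r ^ 2
  obtain ⟨T, η, κ, M, hη, hκ, hM0, hM, hlip⟩ := hu.exists_lipschitz_or_jump hb B
  have hr' : (2 : ℝ) ≤ r := by exact_mod_cast hr
  set W : ℝ := (r + r ^ 2) ^ 2 * (1 + r) with hW
  set P : ℝ := κ * r + r ^ 2 with hP
  -- For `h ≤ h₀` the boundary rows lie where the cones are valid, and cone width plus drift, at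
  -- most `P h`, is at most `√h / 2`. For larger `h` the trivial bound `2 M` is absorbed into `K
  -- √h`.
  set h₀ : ℝ := min (η / r) (1 / (4 * P ^ 2 + 1)) with hh₀
  have hh₀pos : 0 < h₀ := lt_min (by positivity) (by positivity)
  have hP0 : 0 ≤ P := by positivity
  have hW0 : 0 ≤ W := by positivity
  set K : ℝ := 2 * M + 2 * M / √h₀ + 4 * M + M * (1 + r ^ 2 + r + W) + 16 * M * W with hK
  have n1 : 0 ≤ 2 * M / √h₀ := by positivity
  have n2 : 0 ≤ M * (1 + r ^ 2 + r + W) := by positivity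
  have n3 : 0 ≤ 16 * M * W := by positivity
  have hK0 : 0 ≤ K := by positivity
  refine ⟨T, K, hK0, ?_⟩
  intro ρ v hρ N h hh h0 hrh c U hU p₀ hp₀
  set m := v.1 / v.2 with hm
  have hmr : |m| ≤ r := hρ.abs_slope_le
  set x' := p₀.1 * h - m * (p₀.2 * h) with hx'
  have hx'B : |x'| ≤ B := foot_bound hh h0 hmr hp₀
  have hgrid := hp₀
  simp only [pixelGrid, Finset.mem_product, Finset.mem_Icc] at hgrid
  have hh1 : h ≤ 1 := by
    have : (1 : ℤ) ≤ N := by omega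
    have : (1 : ℝ) ≤ N := by exact_mod_cast this
    exact (le_mul_of_one_le_right h0.le this).trans hh.le
  have hsq : √h * √h = h := Real.mul_self_sqrt h0.le
  have hs0 : 0 < √h := Real.sqrt_pos.2 h0
  have hs1 : √h ≤ 1 := Real.sqrt_le_one.2 hh1
  have hhs : h ≤ √h := hsq.symm.le.trans (mul_le_of_le_one_right hs0.le hs1)
  have hdiff : ∀ x y : ℝ, |x| ≤ B → -b ≤ y → y ≤ 0 → |u₀ (x, y) c - u₀ (x', 0) c| ≤ 2 * M := by
    intro x y hx hy hy0
    have f1 := (norm_le_pi_norm (u₀ (x, y)) c).trans (hM x y hx hy hy0)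
    have f2 := (norm_le_pi_norm (u₀ (x', 0)) c).trans (hM x' 0 hx'B (by linarith) le_rfl)
    have := abs_sub (u₀ (x, y) c) (u₀ (x', 0) c)
    simp only [Real.norm_eq_abs] at f1 f2
    linarith
  -- With `B = 0` and `β = 0` the comparison is the maximum principle.
  have hsup : |u₀ (x', 0) c - U p₀| ≤ 2 * M := by
    have key := hρ.abs_sub_le_of_boundary hU.average hh hgrid.2.1 hgrid.2.2
      (ζ := fun p => p.1 * h - x' - m * (p.2 * h)) (fun p => rfl)
      (A := 2 * M) (B := 0) (β := 0) (c := u₀ (x', 0) c) le_rfl ?_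
    · rwa [zero_mul, add_zero, abs_sub_comm] at key
    intro p h1 h2 hcone
    obtain ⟨hpB, hpb, hp0, -⟩ := boundary_pixel_bounds hr hh h0 hrh hp₀ h1 h2 hcone
    rw [hU.boundary p h2, zero_mul, zero_mul, sub_zero, add_zero]
    exact hdiff _ _ hpB hpb hp0
  refine ⟨hsup.trans (by linarith), ?_⟩
  set S := ∑ a ∈ T, h / ((x' - a) ^ 2 + h) with hS
  have hterm : ∀ a, 0 ≤ h / ((x' - a) ^ 2 + h) := fun a => by positivity
  have hS0 : 0 ≤ S := Finset.sum_nonneg fun a _ => hterm a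
  by_cases hbig : h₀ < h
  · have f1 : 2 * M ≤ 2 * M / √h₀ * √h := by
      rw [div_mul_eq_mul_div, le_div_iff₀ (Real.sqrt_pos.2 hh₀pos)]
      exact mul_le_mul_of_nonneg_left (Real.sqrt_le_sqrt hbig.le) (by positivity)
    have f2 : 2 * M / √h₀ * √h ≤ K * (√h + S) :=
      mul_le_mul (by linarith) (by linarith) hs0.le hK0
    linarith
  push Not at hbig
  have hη' : r * h ≤ η := by
    have := hbig.trans (min_le_left _ _)
    rw [le_div_iff₀ (by linarith)] at this
    linarith
  have hPh : 4 * P ^ 2 * h ≤ 1 := by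
    have := hbig.trans (min_le_right _ _)
    rw [le_div_iff₀ (by positivity)] at this
    linarith
  have hPs : 2 * (P * h) ≤ √h := by
    refine Real.le_sqrt_of_sq_le ?_
    calc (2 * (P * h)) ^ 2 = 4 * P ^ 2 * h * h := by ring
      _ ≤ 1 * h := mul_le_mul_of_nonneg_right hPh h0.le
      _ = h := one_mul h
  -- If a jump lies within `√h` of the foot, its term in the sum is at least `1 / 2` and the uniform
  -- bound suffices.
  by_cases hnear : ∃ a ∈ T, (x' - a) ^ 2 ≤ h
  · obtain ⟨a, ha, hah⟩ := hnear
    have f1 : 1 / 2 ≤ h / ((x' - a) ^ 2 + h) := by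
      rw [div_le_div_iff₀ (by norm_num) (by positivity)]
      linarith
    have f2 : h / ((x' - a) ^ 2 + h) ≤ S :=
      Finset.single_le_sum (f := fun a => h / ((x' - a) ^ 2 + h)) (fun a _ => hterm a) ha
    have f3 : 4 * M * S ≤ K * (√h + S) :=
      mul_le_mul (by linarith) (by linarith) hS0 hK0
    have f4 := mul_le_mul_of_nonneg_left (f1.trans f2) (by positivity : 0 ≤ 4 * M)
    linarith
  push Not at hnear
  set E := ∑ a ∈ T, 8 * M / (x' - a) ^ 2 with hE
  have hterm' : ∀ a, 0 ≤ 8 * M / (x' - a) ^ 2 := fun a => by positivity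
  have hE0 : 0 ≤ E := Finset.sum_nonneg fun a _ => hterm' a
  -- In `B`, `M / √h` handles the Lipschitz part through `|ζ| ≤ √h + ζ² / √h`. The terms of `E`
  -- handle the pixels separated from the foot by a jump, in the manner of Chebyshev's inequality.
  have key := hρ.abs_sub_le_of_boundary hU.average hh hgrid.2.1 hgrid.2.2
    (ζ := fun p => p.1 * h - x' - m * (p.2 * h)) (fun p => rfl)
    (A := M * (√h + (r ^ 2 + r) * h)) (B := M / √h + E) (β := 0) (c := u₀ (x', 0) c)
    (by positivity) ?_
  · rw [abs_sub_comm]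
    have f1 : E * h ≤ 16 * M * S := by
      rw [hE, hS, Finset.sum_mul, Finset.mul_sum]
      refine Finset.sum_le_sum fun a ha => ?_
      have g := hnear a ha
      have g0 : 0 < (x' - a) ^ 2 := h0.trans g
      rw [div_mul_eq_mul_div, ← mul_div_assoc, div_le_div_iff₀ g0 (by positivity)]
      have := mul_le_mul_of_nonneg_left g.le (by positivity : 0 ≤ 8 * M * h)
      linarith
    have f2 : M / √h * h = M * √h := by
      rw [div_mul_eq_mul_div, div_eq_iff hs0.ne']
      rw [mul_assoc, hsq]
    have f3 : (M / √h + E) * ((r + r ^ 2) ^ 2 * (1 + r) * h) = M * √h * W + E * h * W := by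
      rw [← f2]; ring
    rw [f3] at key
    have f4 := mul_le_mul_of_nonneg_right f1 hW0
    have f5 : M * ((r ^ 2 + r) * h) ≤ M * ((r ^ 2 + r) * √h) := by gcongr
    have f6 : M * (1 + r ^ 2 + r + W) * √h ≤ K * √h :=
      mul_le_mul_of_nonneg_right (by linarith) hs0.le
    have f7 : 16 * M * W * S ≤ K * S := mul_le_mul_of_nonneg_right (by linarith) hS0
    linarith
  intro p h1 h2 hcone
  obtain ⟨hpB, hpb, hp0, hpr⟩ := boundary_pixel_bounds hr hh h0 hrh hp₀ h1 h2 hcone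
  rw [hU.boundary p h2, zero_mul, sub_zero]
  simp only [pos]
  set x := (p.1 : ℝ) * h
  set y := (p.2 : ℝ) * h
  set ζ := x - x' - m * y with hζ
  have hmy : |m * y| ≤ r ^ 2 * h := by
    rw [abs_mul, sq, mul_assoc]
    exact mul_le_mul hmr hpr (abs_nonneg _) (Nat.cast_nonneg r)
  have hxζ : |x - x'| ≤ |ζ| + r ^ 2 * h := by
    have := abs_add_le ζ (m * y)
    rw [show ζ + m * y = x - x' by rw [hζ]; ring] at this
    linarith only [this, hmy]
  have hyη : -η ≤ y := by linarith only [(abs_le.1 hpr).1, hη']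
  rcases hlip x x' y hpB hx'B hpb hp0 hyη with f1 | ⟨a, ha, hxa⟩
  · have f2 : |u₀ (x, y) c - u₀ (x', 0) c| ≤ M * |y| + M * |x - x'| :=
      (norm_le_pi_norm (u₀ (x, y) - u₀ (x', 0)) c).trans f1
    have f3 : |ζ| ≤ √h + ζ ^ 2 / √h := by
      rw [← sub_le_iff_le_add', le_div_iff₀ hs0, ← sq_abs ζ]
      nlinarith only [sq_nonneg (|ζ| - √h), sq_nonneg |ζ|, sq_nonneg √h]
    have f4 : M * |y| ≤ M * (r * h) := mul_le_mul_of_nonneg_left hpr hM0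
    have f5 : M * |x - x'| ≤ M * (√h + ζ ^ 2 / √h + r ^ 2 * h) :=
      mul_le_mul_of_nonneg_left (by linarith only [hxζ, f3]) hM0
    have f6 : 0 ≤ E * ζ ^ 2 := by positivity
    have f7 : M * (ζ ^ 2 / √h) = M / √h * ζ ^ 2 := by ring
    linarith only [f2, f4, f5, f6, f7]
  · have g0 := hnear a ha
    have g1 : √h ≤ |x' - a| := Real.sqrt_le_iff.2 ⟨abs_nonneg _, by rw [sq_abs]; exact g0.le⟩
    -- Here `|x' - a| ≤ |ζ| + P h` and `P h ≤ √h / 2 ≤ |x' - a| / 2`.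
    have g2 : |x' - a| ≤ 2 * |ζ| := by
      have e1 : P * h = κ * (r * h) + r ^ 2 * h := by rw [hP]; ring
      have e2 := mul_le_mul_of_nonneg_left hpr hκ
      linarith only [e1, e2, hxa, hxζ, hPs, g1]
    have g3 : (x' - a) ^ 2 ≤ 4 * ζ ^ 2 := by
      rw [← sq_abs, ← sq_abs ζ]
      calc |x' - a| ^ 2 ≤ (2 * |ζ|) ^ 2 := by gcongr
        _ = 4 * |ζ| ^ 2 := by ring
    have g4 : 2 * M ≤ 8 * M / (x' - a) ^ 2 * ζ ^ 2 := by
      rw [div_mul_eq_mul_div, le_div_iff₀ (h0.trans g0)]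
      have := mul_le_mul_of_nonneg_left g3 (by positivity : 0 ≤ 2 * M)
      linarith
    have g5 : 8 * M / (x' - a) ^ 2 ≤ E :=
      Finset.single_le_sum (f := fun a => 8 * M / (x' - a) ^ 2) (fun a _ => hterm' a) ha
    have g6 := mul_le_mul_of_nonneg_right g5 (sq_nonneg ζ)
    have g7 : 0 ≤ M / √h * ζ ^ 2 := by positivity
    have g8 : 0 ≤ M * (√h + (r ^ 2 + r) * h) := by positivity
    have g9 := hdiff x y hpB hpb hp0
    linarith only [g4, g6, g7, g8, g9]

/-- The angle `π / 2 - arctan (v.1 / v.2)` lies in `(0, π)` automatically. -/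
theorem exists_isLineAngle {v : ℝ × ℝ} (hv : v.2 ≠ 0) :
    ∃ θ, IsLineAngle v θ ∧ Real.cot θ = v.1 / v.2 := by
  set t := v.1 / v.2 with ht
  have hcos := Real.cos_arctan_pos t
  have hsin : Real.sin (Real.arctan t) = t * Real.cos (Real.arctan t) := by
    have := Real.tan_arctan t
    rw [Real.tan_eq_sin_div_cos, div_eq_iff hcos.ne'] at this
    exact this
  refine ⟨Real.pi / 2 - Real.arctan t, ⟨fun h => hv (by rw [h]; rfl), ⟨?_, ?_⟩, ?_⟩, ?_⟩
  · linarith [Real.arctan_lt_pi_div_two t]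
  · linarith [Real.neg_pi_div_two_lt_arctan t]
  · rw [Real.sin_pi_div_two_sub, Real.cos_pi_div_two_sub, hsin, ht]
    field_simp
  · rw [Real.cot_eq_cos_div_sin, Real.sin_pi_div_two_sub, Real.cos_pi_div_two_sub, hsin,
      mul_div_cancel_right₀ _ hcos.ne']

theorem inpainted_isStencilExtension {d N r : ℕ} {δ h : ℝ} (s : Scheme)
    (u₀ : ℝ × ℝ → Fin d → ℝ) (g : ℝ × ℝ) (μ : ℝ) (hh : h * N = 1) (h0 : 0 < h) (hδ : r * h < δ)
    (c : Fin d) :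
    IsStencilExtension r (stencilWeight s g μ r) N (fun q => u₀ (pos h q) c)
      (fun q => inpainted s δ u₀ g μ r h q c) :=
  ⟨(inpainted_spec s u₀ g μ hh h0 hδ c).1, (inpainted_spec s u₀ g μ hh h0 hδ c).2⟩

/-- The mean error over the grid of a function dominated by the pointwise error bound. -/
theorem sum_pixelGrid_le {N : ℕ} {h K m : ℝ} (hh : h * N = 1) (h0 : 0 < h) (hK : 0 ≤ K)
    (T : Finset ℝ) {f : ℤ × ℤ → ℝ}
    (hf : ∀ q ∈ pixelGrid N, |f q| ≤ K * (√h +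
      ∑ a ∈ T, h / ((q.1 * h - m * (q.2 * h) - a) ^ 2 + h))) :
    ∑ q ∈ pixelGrid N, |f q| * (1 / (N : ℝ)) ^ 2 ≤ K * (1 + 16 * T.card) * √h := by
  have hN : (1 / (N : ℝ)) = h := by rw [one_div]; exact (eq_inv_of_mul_eq_one_left hh).symm
  have hNN : (N : ℝ) * N * h ^ 2 = 1 := by linear_combination (h * N + 1) * hh
  have h1 : ∑ q ∈ pixelGrid N, ∑ a ∈ T, h / (((q.1 : ℝ) * h - m * (q.2 * h) - a) ^ 2 + h)
      ≤ N * (T.card * (16 * (N * √h))) := by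
    calc ∑ q ∈ pixelGrid N, ∑ a ∈ T, h / (((q.1 : ℝ) * h - m * (q.2 * h) - a) ^ 2 + h)
        = ∑ j ∈ Finset.Icc 1 (N : ℤ), ∑ a ∈ T, ∑ i ∈ Finset.Icc 1 (N : ℤ),
            h / (((i : ℝ) * h - (m * (j * h) + a)) ^ 2 + h) := by
          rw [pixelGrid, Finset.sum_product_right]
          refine Finset.sum_congr rfl fun j _ => ?_
          rw [Finset.sum_comm]
          simp only [sub_sub]
      _ ≤ ∑ j ∈ Finset.Icc 1 (N : ℤ), ∑ a ∈ T, 16 * (N * √h) :=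
          Finset.sum_le_sum fun j _ => Finset.sum_le_sum fun a _ => sum_row_le hh h0 _
      _ = N * (T.card * (16 * (N * √h))) := by
          simp only [Finset.sum_const, nsmul_eq_mul, Int.card_Icc, add_sub_cancel_right,
            Int.toNat_natCast]
  rw [hN, ← Finset.sum_mul]
  calc (∑ q ∈ pixelGrid N, |f q|) * h ^ 2
      ≤ (∑ q ∈ pixelGrid N, K * (√h +
          ∑ a ∈ T, h / (((q.1 : ℝ) * h - m * (q.2 * h) - a) ^ 2 + h))) * h ^ 2 :=
        mul_le_mul_of_nonneg_right (Finset.sum_le_sum hf) (sq_nonneg h)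
    _ = K * (N * N * √h + ∑ q ∈ pixelGrid N,
          ∑ a ∈ T, h / (((q.1 : ℝ) * h - m * (q.2 * h) - a) ^ 2 + h)) * h ^ 2 := by
        rw [← Finset.mul_sum, Finset.sum_add_distrib, Finset.sum_const, card_pixelGrid,
          nsmul_eq_mul]
        push_cast; rfl
    _ ≤ K * (N * N * √h + N * (T.card * (16 * (N * √h)))) * h ^ 2 := by gcongr
    _ = K * (1 + 16 * T.card) * √h := by
        linear_combination (K * √h * (1 + 16 * T.card)) * hNN

/-! ### Error norms, uniform in the scheme, `g` and `μ` -/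

section Uniform

variable {d n : ℕ} {δ : ℝ} {u₀ : ℝ × ℝ → Fin d → ℝ} {r : ℕ}

theorem IsPiecewiseC2.exists_discreteNorm_le_of_no_jumps (hδ : 0 < δ) (hr : 2 ≤ r)
    {C : Fin 0 → JumpCurve δ} (hu : IsPiecewiseC2 δ u₀ C) :
    ∃ K : ℝ, 0 ≤ K ∧ ∀ (s : Scheme) (g : ℝ × ℝ) (μ θ : ℝ),
      Real.cot θ = (transportDirection s g μ r).1 / (transportDirection s g μ r).2 →
      ∀ (N : ℕ) (h : ℝ), 0 < N → h * N = 1 → 0 < h → r * h < δ → ∀ p : ℝ≥0∞, 1 ≤ p →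
      ∀ c : Fin d, discreteNorm p N (fun q =>
        weakSolution u₀ θ (pos h q) c - inpainted s δ u₀ g μ r h q c) ≤ K * h := by
  obtain ⟨K, hK, H⟩ := hu.exists_error_le_of_no_jumps hδ hr
  refine ⟨K, hK, fun s g μ θ hθ N h hN hh h0 hrh p hp c => ?_⟩
  refine discreteNorm_le_of_forall_le hp hN (by positivity) fun q hq => ?_
  have := H _ _ (isStencil_stencilWeight s g μ hr) N h hh h0 hrh c _
    (inpainted_isStencilExtension s u₀ g μ hh h0 hrh c) q hq
  rw [← hθ] at this
  exact this

theorem IsPiecewiseC2.exists_discreteNorm_le (hδ : 0 < δ) (hr : 2 ≤ r)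
    {C : Fin n → JumpCurve δ} (hu : IsPiecewiseC2 δ u₀ C) :
    ∃ K : ℝ, 0 ≤ K ∧ ∀ (s : Scheme) (g : ℝ × ℝ) (μ θ : ℝ),
      Real.cot θ = (transportDirection s g μ r).1 / (transportDirection s g μ r).2 →
      ∀ (N : ℕ) (h : ℝ), 0 < N → h * N = 1 → 0 < h → r * h < δ → ∀ p : ℝ≥0∞, 1 ≤ p →
      ∀ c : Fin d, discreteNorm p N (fun q =>
        weakSolution u₀ θ (pos h q) c - inpainted s δ u₀ g μ r h q c)
          ≤ K * h ^ (1 / (2 * p)).toReal := by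
  obtain ⟨T, K, hK, H⟩ := hu.exists_error_le hδ hr
  refine ⟨K * (1 + 16 * T.card), by positivity,
    fun s g μ θ hθ N h hN hh h0 hrh p hp c => ?_⟩
  have hpt := H _ _ (isStencil_stencilWeight s g μ hr) N h hh h0 hrh c _
    (inpainted_isStencilExtension s u₀ g μ hh h0 hrh c)
  rw [← hθ] at hpt
  refine discreteNorm_le_of_sum_le hp hN h0 (by positivity) (fun q hq => ?_)
    (sum_pixelGrid_le hh h0 hK T fun q hq => (hpt q hq).2)
  refine (hpt q hq).1.trans (le_mul_of_one_le_right hK ?_)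
  have : (0 : ℝ) ≤ T.card := Nat.cast_nonneg _
  linarith

end Uniform

end Inpainting

open Inpainting

theorem theorem4p1 (d : ℕ) (δ : ℝ) (hδ : 0 < δ) (u₀ : ℝ × ℝ → Fin d → ℝ) (r : ℕ) (hr : 2 ≤ r) :
    ∃ K : ℝ, ∀ (n : ℕ) (C : Fin n → JumpCurve δ), IsPiecewiseC2 δ u₀ C →
      ∀ (s : Scheme) (g : ℝ × ℝ) (μ : ℝ), 0 < μ →
        (transportDirection s g μ r).2 ≠ 0 ∧
        ∃ θ : ℝ, IsLineAngle (transportDirection s g μ r) θ ∧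
          ∀ (N : ℕ) (h : ℝ), 0 < N → h = 1 / (N : ℝ) → h < δ / r →
            (∃ k, (stateAfter s δ u₀ g μ r h k).region = ∅) ∧
            ∀ p : ℝ≥0∞, 1 ≤ p → ∀ c : Fin d,
              (0 < n →
                discreteNorm p N (fun q =>
                    weakSolution u₀ θ (pos h q) c - inpainted s δ u₀ g μ r h q c)
                  ≤ K * h ^ (1 / (2 * p)).toReal) ∧
              (n = 0 →
                discreteNorm p N (fun q =>
                    weakSolution u₀ θ (pos h q) c - inpainted s δ u₀ g μ r h q c)
                  ≤ K * h) := by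
  have hr0 : (0 : ℝ) < r := by
    have : (2 : ℝ) ≤ r := by exact_mod_cast hr
    linarith
  -- The constant must precede the choice of curves. The error bound mentions only `u₀`, so the
  -- constant from any one admissible family of curves serves for all; if there is none, `0` will
  -- do. The bound for an empty family is obtained separately in the same way.
  obtain ⟨K₁, hK₁⟩ : ∃ K₁ : ℝ, (∃ (n : ℕ) (C : Fin n → JumpCurve δ), IsPiecewiseC2 δ u₀ C) →
      ∀ (s : Scheme) (g : ℝ × ℝ) (μ θ : ℝ),
      Real.cot θ = (transportDirection s g μ r).1 / (transportDirection s g μ r).2 →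
      ∀ (N : ℕ) (h : ℝ), 0 < N → h * N = 1 → 0 < h → r * h < δ → ∀ p : ℝ≥0∞, 1 ≤ p →
      ∀ c : Fin d, discreteNorm p N (fun q =>
        weakSolution u₀ θ (pos h q) c - inpainted s δ u₀ g μ r h q c)
          ≤ K₁ * h ^ (1 / (2 * p)).toReal := by
    by_cases hex : ∃ (n : ℕ) (C : Fin n → JumpCurve δ), IsPiecewiseC2 δ u₀ C
    · obtain ⟨n, C, hu⟩ := hex
      obtain ⟨K, -, hK⟩ := hu.exists_discreteNorm_le hδ hr
      exact ⟨K, fun _ => hK⟩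
    · exact ⟨0, fun h => absurd h hex⟩
  obtain ⟨K₂, hK₂⟩ : ∃ K₂ : ℝ, (∃ C : Fin 0 → JumpCurve δ, IsPiecewiseC2 δ u₀ C) →
      ∀ (s : Scheme) (g : ℝ × ℝ) (μ θ : ℝ),
      Real.cot θ = (transportDirection s g μ r).1 / (transportDirection s g μ r).2 →
      ∀ (N : ℕ) (h : ℝ), 0 < N → h * N = 1 → 0 < h → r * h < δ → ∀ p : ℝ≥0∞, 1 ≤ p →
      ∀ c : Fin d, discreteNorm p N (fun q =>
        weakSolution u₀ θ (pos h q) c - inpainted s δ u₀ g μ r h q c) ≤ K₂ * h := by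
    by_cases hex : ∃ C : Fin 0 → JumpCurve δ, IsPiecewiseC2 δ u₀ C
    · obtain ⟨C, hu⟩ := hex
      obtain ⟨K, -, hK⟩ := hu.exists_discreteNorm_le_of_no_jumps hδ hr
      exact ⟨K, fun _ => hK⟩
    · exact ⟨0, fun h => absurd h hex⟩
  refine ⟨max K₁ K₂, fun n C hu s g μ _ => ?_⟩
  have hv : (transportDirection s g μ r).2 ≠ 0 := by
    have := (isStencil_stencilWeight s g μ hr).snd_le
    intro h
    linarith
  obtain ⟨θ, hθ, hcot⟩ := exists_isLineAngle hv
  refine ⟨hv, θ, hθ, fun N h hN hhN hhδ => ?_⟩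
  have hN0 : (0 : ℝ) < N := by exact_mod_cast hN
  have h0 : 0 < h := by rw [hhN]; positivity
  have hh : h * N = 1 := by rw [hhN]; field_simp
  have hrh : r * h < δ := by rwa [lt_div_iff₀ hr0, mul_comm] at hhδ
  refine ⟨exists_region_eq_empty s u₀ g μ hh h0 hrh, fun p hp c => ⟨fun _ => ?_, fun hn => ?_⟩⟩
  · refine (hK₁ ⟨n, C, hu⟩ s g μ θ hcot N h hN hh h0 hrh p hp c).trans ?_
    exact mul_le_mul_of_nonneg_right (le_max_left _ _) (by positivity)
  · subst hn
    refine (hK₂ ⟨C, hu⟩ s g μ θ hcot N h hN hh h0 hrh p hp c).trans ?_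
    exact mul_le_mul_of_nonneg_right (le_max_right _ _) h0.le
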